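/- Let $H_0 f=-f''$ with domain $\operatorname{dom}(H_0)=H^2(\mathbb R)$ be the self-adjoint realization of $-d^2/dx^2$ in $L^2(\mathbb R)$ (complex-valued functions), and write $\widehat f(\xi)=(2\pi)^{-1/2}\int_{\mathbb R}e^{-i\xi x}f(x)\,dx$. For a complex-valued Schwartz function $V\in\mathcal S(\mathbb R)$ put $v=|V|^{1/2}$ and $u=|V|^{1/2}e^{i\arg(V)}$, so that $V=uv$; $V$, $u$ and $v$ also denote the corresponding bounded multiplication operators in $L^2(\mathbb R)$. Let $\mathcal B_1(L^2(\mathbb R))$ and $\mathcal B_2(L^2(\mathbb R))$ denote the trace class and the Hilbert--Schmidt class. **Proposition.** If $V\in\mathcal S(\mathbb R)$ and $\kappa\in(0,\infty)$, then $$A_V(-\kappa^2):=-\big(H_0+\kappa^2 I\big)^{-1/2}\,V\,\big(H_0+\kappa^2 I\big)^{-1/2}\in\mathcal B_1\big(L^2(\mathbb R)\big),$$ the operator $u(H_0+\kappa^2 I)^{-1}v$ is trace class as well, and $$\operatorname{tr}\big(A_V(-\kappa^2)\big)=-\frac1{2\kappa}\int_{\mathbb R}V(x)\,dx=-\operatorname{tr}\big(u\,(H_0+\kappa^2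 I)^{-1}\,v\big),$$ $$\big\|A_V(-\kappa^2)\big\|_{\mathcal B_2(L^2(\mathbb R))}^2=\frac1\kappa\int_{\mathbb R}\frac{|\widehat V(\eta)|^2}{\eta^2+4\kappa^2}\,d\eta .$$ -/

import Mathlib

open MeasureTheory Complex
open scoped SchwartzMap ENNReal Real LineDeriv Laplacian FourierTransform

noncomputable section

namespace BirmanSchwinger

section Abstract

universe w

variable {H : Type w} [NormedAddCommGroup H] [InnerProductSpace ℂ H]

/-- `R` is the bounded two-sided inverse of `T - z`, where `T` is an unbounded operator in `H`. -/
def IsResolvent (T : H →ₗ.[ℂ] H) (z : ℂ) (R : H →L[ℂ] H) : Prop :=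
  (∀ f : H, ∃ h : R f ∈ T.domain, T ⟨R f, h⟩ - z • R f = f) ∧
    ∀ f : T.domain, R (T f - z • (f : H)) = f

theorem IsResolvent.unique {T : H →ₗ.[ℂ] H} {z : ℂ} {R R' : H →L[ℂ] H}
    (h : IsResolvent T z R) (h' : IsResolvent T z R') : R = R' := by
  ext f
  obtain ⟨hf, e⟩ := h.1 f
  have := h'.2 ⟨R f, hf⟩
  rw [e] at this
  exact this.symm

open Classical in
/-- The resolvent `(T - z)⁻¹` (set to `0` when `z` is not in the resolvent set of `T`). -/
def resolventOp (T : H →ₗ.[ℂ] H) (z : ℂ) : H →L[ℂ] H :=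
  if h : ∃ R, IsResolvent T z R then h.choose else 0

theorem IsResolvent.resolventOp_eq {T : H →ₗ.[ℂ] H} {z : ℂ} {R : H →L[ℂ] H}
    (h : IsResolvent T z R) : resolventOp T z = R := by
  have h' : ∃ R, IsResolvent T z R := ⟨R, h⟩
  rw [resolventOp, dif_pos h']
  exact h'.choose_spec.unique h

variable [CompleteSpace H]

/-- The nonnegative square root of a nonnegative bounded operator. -/
def sqrtOp (R : H →L[ℂ] H) : H →L[ℂ] H := CFC.sqrt R

/-- `T` belongs to the trace class `𝓑₁(H)`: `tr |T| < ∞`, where `|T| = (T* T)^{1/2}`. -/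
def IsTraceClass (T : H →L[ℂ] H) : Prop :=
  ∀ (ι : Type w) (b : HilbertBasis ι ℂ H),
    Summable fun i ↦ (inner ℂ (b i) (CFC.abs T (b i))).re

/-- `T` is trace class with trace `t`, that is, `∑ᵢ (bᵢ, T bᵢ) = t` for every
orthonormal basis `b` of `H`. -/
def HasTrace (T : H →L[ℂ] H) (t : ℂ) : Prop :=
  IsTraceClass T ∧
    ∀ (ι : Type w) (b : HilbertBasis ι ℂ H), HasSum (fun i ↦ inner ℂ (b i) (T (b i))) t

/-- `T` belongs to the Hilbert-Schmidt class `𝓑₂(H)` and `‖T‖_{𝓑₂(H)} = c`, that is, `0 ≤ c` and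
`∑ᵢ ‖T bᵢ‖² = c²` for every orthonormal basis `b` of `H`. -/
def HasHilbertSchmidtNorm (T : H →L[ℂ] H) (c : ℝ) : Prop :=
  0 ≤ c ∧ ∀ (ι : Type w) (b : HilbertBasis ι ℂ H), HasSum (fun i ↦ ‖T (b i)‖ ^ 2) (c ^ 2)

end Abstract

/-- The Hilbert space `L²(ℝ)` of complex-valued functions. -/
abbrev L2 : Type := Lp ℂ 2 (volume : Measure ℝ)

/-- The embedding `L²(ℝ) → 𝓢'(ℝ)`. -/
abbrev toDistr : L2 →L[ℂ] 𝓢'(ℝ, ℂ) := Lp.toTemperedDistributionCLM ℂ volume 2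

theorem toDistr_injective : Function.Injective toDistr :=
  LinearMap.ker_eq_bot.mp (Lp.ker_toTemperedDistributionCLM_eq_bot (F := ℂ) (E := ℝ)
    (μ := volume) (p := 2))

theorem derivCLM_eq_lineDeriv (f : 𝓢'(ℝ, ℂ)) :
    TemperedDistribution.derivCLM ℂ f = ∂_{(1 : ℝ)} f := by
  ext g
  rw [TemperedDistribution.derivCLM_apply_apply, TemperedDistribution.lineDerivOp_apply_apply]
  congr 2

/-- If `f ∈ H²(ℝ)`, then the distribution `f''` is in `L²(ℝ)`. -/
theorem exists_neg_deriv_deriv (f : L2)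
    (hf : TemperedDistribution.MemSobolev 2 2 (toDistr f)) :
    ∃ g : L2, toDistr g =
      -TemperedDistribution.derivCLM ℂ (TemperedDistribution.derivCLM ℂ (toDistr f)) := by
  have h1 := (hf.lineDerivOp (m := (1 : ℝ))).lineDerivOp (m := (1 : ℝ))
  norm_num at h1
  obtain ⟨g, hg⟩ := TemperedDistribution.memSobolev_zero_iff.mp h1
  refine ⟨-g, ?_⟩
  rw [derivCLM_eq_lineDeriv, derivCLM_eq_lineDeriv, map_neg]
  exact congrArg Neg.neg hg.symm

/-- The Sobolev space `H²(ℝ)` as a subspace of `L²(ℝ)`. -/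
def sobolevH2 : Submodule ℂ L2 where
  carrier := {f | TemperedDistribution.MemSobolev 2 2 (toDistr f)}
  zero_mem' := by
    rw [Set.mem_ofPred_eq, map_zero]
    exact TemperedDistribution.memSobolev_fun_zero ℝ ℂ 2 2
  add_mem' := by
    intro f g hf hg
    rw [Set.mem_ofPred_eq, map_add]
    exact TemperedDistribution.MemSobolev.add hf hg
  smul_mem' := by
    intro c f hf
    rw [Set.mem_ofPred_eq, map_smul]
    exact TemperedDistribution.MemSobolev.smul c hf

/-- The operator `H₀ f = -f''` in `L²(ℝ)` with domain `H²(ℝ)`, where `f''` is the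
distributional second derivative. -/
def freeHamiltonian : L2 →ₗ.[ℂ] L2 where
  domain := sobolevH2
  toFun :=
    { toFun := fun f ↦ (exists_neg_deriv_deriv f f.2).choose
      map_add' := by
        intro f g
        apply toDistr_injective
        rw [map_add, (exists_neg_deriv_deriv _ (f + g).2).choose_spec,
          (exists_neg_deriv_deriv _ f.2).choose_spec, (exists_neg_deriv_deriv _ g.2).choose_spec]
        simp only [Submodule.coe_add, map_add, neg_add]
      map_smul' := by
        intro c f
        apply toDistr_injective
        rw [map_smul, (exists_neg_deriv_deriv _ (c • f).2).choose_spec,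
          (exists_neg_deriv_deriv _ f.2).choose_spec]
        simp only [Submodule.coe_smul, map_smul, smul_neg, RingHom.id_apply] }

theorem toDistr_freeHamiltonian (f : freeHamiltonian.domain) :
    toDistr (freeHamiltonian f) =
      -TemperedDistribution.derivCLM ℂ (TemperedDistribution.derivCLM ℂ (toDistr f)) :=
  (exists_neg_deriv_deriv f f.2).choose_spec

/-- The free resolvent `(H₀ + κ²)⁻¹`. -/
def freeResolvent (κ : ℝ) : L2 →L[ℂ] L2 :=
  resolventOp freeHamiltonian (-(κ : ℂ) ^ 2)

/-- The operator `(H₀ + κ²)^{-1/2}`: the nonnegative square root of the nonnegative bounded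
operator `(H₀ + κ²)⁻¹`. -/
def freeResolventSqrt (κ : ℝ) : L2 →L[ℂ] L2 :=
  sqrtOp (freeResolvent κ)

/-- The bounded operator of multiplication by `g ∈ L^∞(ℝ)` in `L²(ℝ)`. -/
def mulOp (g : ℝ → ℂ) (hg : MemLp g ∞ volume) : L2 →L[ℂ] L2 :=
  (ContinuousLinearMap.mul ℂ ℂ).holderL volume ∞ 2 2 (hg.toLp g)

theorem coeFn_mulOp (g : ℝ → ℂ) (hg : MemLp g ∞ volume) (f : L2) :
    mulOp g hg f =ᵐ[volume] fun x ↦ g x * f x := by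
  filter_upwards [(ContinuousLinearMap.mul ℂ ℂ).coeFn_holder (r := 2) (hg.toLp g) f,
    hg.coeFn_toLp] with x h1 h2
  rw [h2] at h1
  exact h1

/-- The factor `v = |V|^{1/2}` of `V = u v`. -/
def factorV (V : 𝓢(ℝ, ℂ)) (x : ℝ) : ℂ := (√‖V x‖ : ℝ)

/-- The factor `u = |V|^{1/2} e^{i arg V}` of `V = u v`. -/
def factorU (V : 𝓢(ℝ, ℂ)) (x : ℝ) : ℂ := (√‖V x‖ : ℝ) * exp (I * (arg (V x) : ℝ))

theorem factorU_mul_factorV (V : 𝓢(ℝ, ℂ)) (x : ℝ) : factorU V x * factorV V x = V x := by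
  rw [factorU, factorV, mul_right_comm, ← ofReal_mul, Real.mul_self_sqrt (norm_nonneg _), mul_comm I]
  exact norm_mul_exp_arg_mul_I (V x)

theorem memLp_factorV (V : 𝓢(ℝ, ℂ)) : MemLp (factorV V) ∞ volume := by
  obtain ⟨C, hC⟩ := V.toBoundedContinuousFunction.bddAbove_range_norm_comp
  refine memLp_top_of_bound (C := √C) ?_ (Filter.Eventually.of_forall fun x ↦ ?_)
  · exact (continuous_ofReal.comp
      (Real.continuous_sqrt.comp V.continuous.norm)).aestronglyMeasurable
  · rw [factorV, norm_real, Real.norm_of_nonneg (Real.sqrt_nonneg _)]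
    exact Real.sqrt_le_sqrt (hC ⟨x, rfl⟩)

theorem memLp_factorU (V : 𝓢(ℝ, ℂ)) : MemLp (factorU V) ∞ volume := by
  refine (memLp_factorV V).of_le ?_ (Filter.Eventually.of_forall fun x ↦ ?_)
  · refine (Measurable.mul ?_ ?_).aestronglyMeasurable
    · exact (continuous_ofReal.comp (Real.continuous_sqrt.comp V.continuous.norm)).measurable
    · exact measurable_exp.comp ((measurable_ofReal.comp
        (measurable_arg.comp V.continuous.measurable)).const_mul I)
  · rw [factorU, factorV, norm_mul, mul_comm I, norm_exp_ofReal_mul_I, mul_one]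

/-- The Birman-Schwinger operator
`A_V(-κ²) = -(H₀ + κ²)^{-1/2} V (H₀ + κ²)^{-1/2}` in `L²(ℝ)`. -/
def birmanSchwinger (V : 𝓢(ℝ, ℂ)) (κ : ℝ) : L2 →L[ℂ] L2 :=
  -(freeResolventSqrt κ ∘L mulOp V (V.memLp_top volume) ∘L freeResolventSqrt κ)

/-- The operator `u (H₀ + κ²)⁻¹ v` in `L²(ℝ)`. -/
def symmetrizedResolvent (V : 𝓢(ℝ, ℂ)) (κ : ℝ) : L2 →L[ℂ] L2 :=
  mulOp (factorU V) (memLp_factorU V) ∘L freeResolvent κ ∘L mulOp (factorV V) (memLp_factorV V)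

/-- The unitary Fourier transform `(2π)^{-1/2} ∫ e^{-i ξ x} f(x) dx`. -/
def unitaryFourier (f : ℝ → ℂ) (ξ : ℝ) : ℂ :=
  ((√(2 * π))⁻¹ : ℝ) * ∫ x : ℝ, exp (-(I * ξ * x)) * f x

/-- The symbol `1 / ((2πξ)² + κ²)` of `(H₀ + κ²)⁻¹` for the Fourier transform with
kernel `e^{-2πi ξ x}`. -/
def resolventSymbol (κ : ℝ) (ξ : ℝ) : ℂ := (((2 * π) ^ 2 * ‖ξ‖ ^ 2 + κ ^ 2)⁻¹ : ℝ)

theorem den_pos {κ : ℝ} (hκ : 0 < κ) (ξ : ℝ) : 0 < (2 * π) ^ 2 * ‖ξ‖ ^ 2 + κ ^ 2 := by positivity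

theorem resolventSymbol_temperate {κ : ℝ} (hκ : 0 < κ) : (resolventSymbol κ).HasTemperateGrowth := by
  have h : (fun ξ : ℝ ↦ (1 + ‖(2 * π / κ) • ξ‖ ^ 2) ^ (-1 : ℝ)).HasTemperateGrowth := by
    have := Function.hasTemperateGrowth_one_add_norm_sq_rpow ℝ (-1)
    exact this.comp (g := fun x ↦ (1 + ‖x‖ ^ 2) ^ (-1 : ℝ)) (f := fun ξ : ℝ ↦ (2 * π / κ) • ξ) (by fun_prop)
  have e : resolventSymbol κ = fun ξ ↦ ((κ ^ 2)⁻¹ : ℂ) * (((1 + ‖(2 * π / κ) • ξ‖ ^ 2) ^ (-1 : ℝ) : ℝ) : ℂ) := by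
    ext ξ
    rw [resolventSymbol, Real.rpow_neg_one]
    norm_cast
    rw [← mul_inv]
    congr 1
    have hp := Real.pi_pos
    rw [norm_smul, Real.norm_of_nonneg (r := 2 * π / κ) (by positivity)]
    field_simp
    ring
  rw [e]
  fun_prop

theorem resolventSymbol_bound {κ : ℝ} (hκ : 0 < κ) (ξ : ℝ) : ‖resolventSymbol κ ξ‖ ≤ (κ ^ 2)⁻¹ := by
  rw [resolventSymbol, norm_real, Real.norm_of_nonneg (inv_nonneg.mpr (den_pos hκ ξ).le)]
  apply inv_anti₀ (by positivity)
  have : 0 ≤ (2 * π) ^ 2 * ‖ξ‖ ^ 2 := by positivity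
  linarith

theorem memLp_resolventSymbol {κ : ℝ} (hκ : 0 < κ) : MemLp (resolventSymbol κ) ∞ volume :=
  memLp_top_of_bound (resolventSymbol_temperate hκ).1.continuous.aestronglyMeasurable _
    (Filter.Eventually.of_forall (resolventSymbol_bound hκ))

/-- The Fourier multiplier with symbol `1 / ((2πξ)² + κ²)` in `L²(ℝ)`. -/
def multiplierResolvent {κ : ℝ} (hκ : 0 < κ) : L2 →L[ℂ] L2 :=
  (Lp.fourierTransformₗᵢ ℝ ℂ).symm.toContinuousLinearEquiv.toContinuousLinearMap ∘L
    mulOp (resolventSymbol κ) (memLp_resolventSymbol hκ) ∘L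
    (Lp.fourierTransformₗᵢ ℝ ℂ).toContinuousLinearEquiv.toContinuousLinearMap

theorem multiplierResolvent_apply {κ : ℝ} (hκ : 0 < κ) (f : L2) :
    multiplierResolvent hκ f = 𝓕⁻ (mulOp (resolventSymbol κ) (memLp_resolventSymbol hκ) (𝓕 f)) := rfl

theorem toDistr_mulOp {g : ℝ → ℂ} (hg : MemLp g ∞ volume) (hg' : g.HasTemperateGrowth) (f : L2) :
    toDistr (mulOp g hg f) = TemperedDistribution.smulLeftCLM ℂ g (toDistr f) := by
  have := Lp.toTemperedDistribution_smul_eq (r := 2) hg' hg f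
  exact this

theorem toDistr_multiplierResolvent {κ : ℝ} (hκ : 0 < κ) (f : L2) :
    toDistr (multiplierResolvent hκ f) = TemperedDistribution.fourierMultiplierCLM ℂ (resolventSymbol κ) (toDistr f) := by
  rw [multiplierResolvent_apply, TemperedDistribution.fourierMultiplierCLM_apply]
  have h1 := Lp.fourierInv_toTemperedDistribution_eq (mulOp (resolventSymbol κ) (memLp_resolventSymbol hκ) (𝓕 f))
  have h2 := Lp.fourier_toTemperedDistribution_eq f
  have h3 := toDistr_mulOp (memLp_resolventSymbol hκ) (resolventSymbol_temperate hκ) (𝓕 f)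
  refine h1.symm.trans ?_
  congr 1
  refine h3.trans ?_
  congr 1
  exact h2.symm

theorem neg_deriv_deriv (f : 𝓢'(ℝ, ℂ)) :
    -TemperedDistribution.derivCLM ℂ (TemperedDistribution.derivCLM ℂ f) =
    TemperedDistribution.fourierMultiplierCLM ℂ
      (fun ξ : ℝ ↦ (((2 * π) ^ 2 * ‖ξ‖ ^ 2 : ℝ) : ℂ)) f := by
  have e : TemperedDistribution.derivCLM ℂ (TemperedDistribution.derivCLM ℂ f) = Δ f := by
    rw [derivCLM_eq_lineDeriv, derivCLM_eq_lineDeriv,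
      TemperedDistribution.laplacian_eq_sum (OrthonormalBasis.singleton (Fin 1) ℝ)]
    simp
  rw [e, TemperedDistribution.laplacian_eq_fourierMultiplierCLM]
  have : (fun ξ : ℝ ↦ (((2 * π) ^ 2 * ‖ξ‖ ^ 2 : ℝ) : ℂ)) =
      (((2 * π) ^ 2 : ℝ) : ℂ) • (fun ξ : ℝ ↦ ((‖ξ‖ ^ 2 : ℝ) : ℂ)) := by
    ext ξ; simp
  rw [this, TemperedDistribution.fourierMultiplierCLM_smul (by fun_prop)]
  rw [neg_smul, neg_neg]
  rfl

theorem resolventSymbol_mul {κ : ℝ} (hκ : 0 < κ) (f : 𝓢'(ℝ, ℂ)) :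
    TemperedDistribution.fourierMultiplierCLM ℂ
      (fun ξ : ℝ ↦ (((2 * π) ^ 2 * ‖ξ‖ ^ 2 : ℝ) : ℂ))
      (TemperedDistribution.fourierMultiplierCLM ℂ (resolventSymbol κ) f) + (κ : ℂ) ^ 2 •
      (TemperedDistribution.fourierMultiplierCLM ℂ (resolventSymbol κ) f) = f := by
  rw [TemperedDistribution.fourierMultiplierCLM_fourierMultiplierCLM_apply (resolventSymbol_temperate hκ)
    (by fun_prop)]
  rw [TemperedDistribution.fourierMultiplierCLM_apply, TemperedDistribution.fourierMultiplierCLM_apply,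
    ← FourierTransform.fourierInv_smul, ← FourierTransform.fourierInv_add]
  have := resolventSymbol_temperate hκ
  have h2 : (κ : ℂ) ^ 2 • TemperedDistribution.smulLeftCLM ℂ (resolventSymbol κ) (𝓕 f) =
      TemperedDistribution.smulLeftCLM ℂ ((κ : ℂ) ^ 2 • resolventSymbol κ) (𝓕 f) := by
    rw [TemperedDistribution.smulLeftCLM_smul this]; rfl
  rw [h2, ← add_apply, ← TemperedDistribution.smulLeftCLM_add (by fun_prop)
    (by simp only [Pi.smul_def, smul_eq_mul]; fun_prop)]
  have e : (resolventSymbol κ * (fun ξ : ℝ ↦ (((2 * π) ^ 2 * ‖ξ‖ ^ 2 : ℝ) : ℂ)) + (κ : ℂ) ^ 2 • resolventSymbol κ) = fun _ ↦ 1 := by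
    ext ξ
    have := (den_pos hκ ξ).ne'
    simp only [Pi.add_apply, Pi.mul_apply, Pi.smul_apply, resolventSymbol, smul_eq_mul]
    norm_cast
    field_simp
  rw [e, TemperedDistribution.smulLeftCLM_const, one_smul, FourierTransform.fourierInv_fourier_eq]

theorem isResolvent_multiplierResolvent {κ : ℝ} (hκ : 0 < κ) :
    IsResolvent freeHamiltonian (-(κ : ℂ) ^ 2) (multiplierResolvent hκ) := by
  have dom : ∀ f, multiplierResolvent hκ f ∈ freeHamiltonian.domain := by
    intro f
    change TemperedDistribution.MemSobolev 2 2 (toDistr (multiplierResolvent hκ f))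
    rw [show (2 : ℝ) = 2 + 0 by norm_num, ← TemperedDistribution.memSobolev_besselPotential_iff,
      toDistr_multiplierResolvent, TemperedDistribution.besselPotential,
      TemperedDistribution.fourierMultiplierCLM_fourierMultiplierCLM_apply
        (resolventSymbol_temperate hκ) (by fun_prop)]
    have h0 : TemperedDistribution.MemSobolev 0 2 (toDistr f) :=
      TemperedDistribution.memSobolev_zero_iff.mpr ⟨f, rfl⟩
    have := resolventSymbol_temperate hκ
    refine h0.fourierMultiplierCLM_of_bounded (by fun_prop) ⟨1 / (2 * π) ^ 2 + 1 / κ ^ 2, fun x ↦ ?_⟩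
    have hd := den_pos hκ x
    rw [Pi.mul_apply, resolventSymbol, mul_comm, ← ofReal_mul, norm_real]
    norm_num only [Real.rpow_one]
    rw [Real.norm_of_nonneg (mul_nonneg (by positivity) (inv_nonneg.mpr hd.le)),
      ← div_eq_mul_inv, div_le_iff₀ hd]
    have hp : 0 < (2 * π) ^ 2 := by positivity
    have hk : 0 < κ ^ 2 := by positivity
    have : (1 / (2 * π) ^ 2 + 1 / κ ^ 2) * ((2 * π) ^ 2 * ‖x‖ ^ 2 + κ ^ 2) =
      1 + ‖x‖ ^ 2 + (κ ^ 2 / (2 * π) ^ 2 + ((2 * π) ^ 2 * ‖x‖ ^ 2) / κ ^ 2) := by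
      field_simp; ring
    rw [this]
    have : 0 ≤ κ ^ 2 / (2 * π) ^ 2 + ((2 * π) ^ 2 * ‖x‖ ^ 2) / κ ^ 2 := by positivity
    linarith
  refine ⟨fun f ↦ ⟨dom f, ?_⟩, fun f ↦ ?_⟩
  · apply toDistr_injective
    rw [neg_smul, sub_neg_eq_add, map_add, map_smul, toDistr_freeHamiltonian, neg_deriv_deriv]
    simp only [toDistr_multiplierResolvent]
    exact resolventSymbol_mul hκ _
  · apply toDistr_injective
    rw [neg_smul, sub_neg_eq_add, toDistr_multiplierResolvent, map_add, map_smul, toDistr_freeHamiltonian,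
      neg_deriv_deriv, map_add, map_smul]
    have := resolventSymbol_mul hκ (toDistr f)
    rw [TemperedDistribution.fourierMultiplierCLM_fourierMultiplierCLM_apply (resolventSymbol_temperate hκ)
      (by fun_prop), mul_comm] at this
    rwa [TemperedDistribution.fourierMultiplierCLM_fourierMultiplierCLM_apply (by fun_prop)
      (resolventSymbol_temperate hκ)]

/-- For `κ > 0`, `-κ²` is in the resolvent set of `H₀`. -/
theorem isResolvent_freeResolvent {κ : ℝ} (hκ : 0 < κ) :
    IsResolvent freeHamiltonian (-(κ : ℂ) ^ 2) (freeResolvent κ) := by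
  rw [freeResolvent, (isResolvent_multiplierResolvent hκ).resolventOp_eq]
  exact isResolvent_multiplierResolvent hκ

/-- For `κ > 0`, `(H₀ + κ²)⁻¹` is nonnegative. -/
theorem freeResolvent_nonneg {κ : ℝ} (hκ : 0 < κ) : 0 ≤ freeResolvent κ := by
  rw [freeResolvent, (isResolvent_multiplierResolvent hκ).resolventOp_eq,
    ContinuousLinearMap.nonneg_iff_isPositive, ContinuousLinearMap.isPositive_iff_complex]
  intro f
  have h : inner ℂ (multiplierResolvent hκ f) f = ((∫ ξ, ((2 * π) ^ 2 * ‖ξ‖ ^ 2 + κ ^ 2)⁻¹ * ‖(𝓕 f : L2) ξ‖ ^ 2 : ℝ) : ℂ) := by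
    rw [← Lp.inner_fourier_eq, multiplierResolvent_apply, FourierTransform.fourier_fourierInv_eq, L2.inner_def,
      ← integral_complex_ofReal]
    apply integral_congr_ae
    filter_upwards [coeFn_mulOp (resolventSymbol κ) (memLp_resolventSymbol hκ) (𝓕 f)] with ξ hξ
    rw [hξ, RCLike.inner_apply, map_mul, resolventSymbol, conj_ofReal, mul_left_comm, mul_conj,
      normSq_eq_norm_sq, ofReal_mul]
  rw [h]
  refine ⟨by simp, ?_⟩
  rw [RCLike.re_eq_complex_re, ofReal_re]
  exact integral_nonneg fun ξ ↦ mul_nonneg (inv_nonneg.mpr (den_pos hκ ξ).le) (by positivity)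

end BirmanSchwinger

end

noncomputable section

namespace BirmanSchwinger

/-! ### Hilbert-Schmidt operators and traces of their products -/

section Abstract

universe w

variable {H : Type w} [NormedAddCommGroup H] [InnerProductSpace ℂ H]

/-! Put `G = (H₀ + κ²)^{-1/2}`, `X = vG` and `Y = uG`. Since `V = vu`, the two operators of the
theorem are `-X*Y` and `YX*`. Everything about traces therefore reduces to `X` and `Y` being
Hilbert-Schmidt and to the value of `∑ ⟨X bᵢ, Y bᵢ⟩`.

Both facts come from pointwise representations `(T f)(x) = ⟨φₓ, f⟩`: Parseval for `φₓ` gives `∑ ‖T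
bᵢ‖² = ∫ ‖φₓ‖² dx`, and its polarized form gives the mixed sums (`tsum_enorm_sq_eq_lintegral`,
`hasSum_inner_of_representation`). For `X` and `Y` the vectors are `conj v(x) gₓ` and `conj u(x)
gₓ`. On the Fourier side `gₓ` is the symbol of `G` times a phase, up to conjugation, so `‖gₓ‖² = ∫
dξ / ((2πξ)² + κ²) = 1/(2κ)` for every `x`. The mixed sum is then `(2κ)⁻¹ ∫ uv = (2κ)⁻¹ ∫ V`.

A product `X*Y` of Hilbert-Schmidt operators is trace class by Douglas' lemma, and `tr(X*Y) =
tr(YX*)` by interchanging a double sum.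

For the Hilbert-Schmidt norm, `A_V` is followed by the unitary Fourier transform, which does not
change the norm. In momentum space the squared kernel has modulus `ρ(ξ) |𝓕V(ξ - η)|² ρ(η)`, where
`ρ(ξ) = 1/((2πξ)² + κ²)`. Tonelli leaves the integral of `|𝓕V(ζ)|²` against `∫ ρ(ξ) ρ(ξ - ζ) dξ`,
which is computed by partial fractions (`integral_inv_sq_add_sq_mul`). -/

theorem tsum_enorm_inner_sq {ι : Type*} (c : HilbertBasis ι ℂ H) (x : H) :
    ∑' i, ‖inner ℂ (c i) x‖ₑ ^ 2 = ‖x‖ₑ ^ 2 := by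
  have h := (c.hasSum_inner_mul_inner x x).mapL Complex.reCLM
  have e : ∀ i, Complex.reCLM (inner ℂ x (c i) * inner ℂ (c i) x) = ‖inner ℂ (c i) x‖ ^ 2 := by
    intro i
    rw [← inner_conj_symm, Complex.reCLM_apply, ← Complex.normSq_eq_conj_mul_self,
      Complex.normSq_eq_norm_sq, Complex.ofReal_re]
  have e' : Complex.reCLM (inner ℂ x x) = ‖x‖ ^ 2 := by
    rw [inner_self_eq_norm_sq_to_K]
    norm_cast
  simp only [e, e'] at h
  have h2 := ENNReal.ofReal_tsum_of_nonneg (fun i ↦ sq_nonneg _) h.summable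
  rw [h.tsum_eq] at h2
  simp only [← ofReal_norm, ← ENNReal.ofReal_pow (norm_nonneg _)]
  exact h2.symm

/-- Hilbert-Schmidt sums are manipulated in `ℝ≥0∞`, where Tonelli needs no summability; this lemma
and `tsum_norm_sq` translate back to real sums. -/
theorem summable_norm_sq_iff {ι E : Type*} [NormedAddCommGroup E] (f : ι → E) :
    Summable (fun i ↦ ‖f i‖ ^ 2) ↔ ∑' i, ‖f i‖ₑ ^ 2 ≠ ∞ := by
  refine ⟨fun h ↦ ?_, fun h ↦ by simpa using ENNReal.summable_toReal h⟩
  have := ENNReal.ofReal_tsum_of_nonneg (fun i ↦ sq_nonneg ‖f i‖) h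
  simp only [ENNReal.ofReal_pow (norm_nonneg _), ofReal_norm] at this
  rw [← this]
  exact ENNReal.ofReal_ne_top

theorem tsum_norm_sq {ι E : Type*} [NormedAddCommGroup E] (f : ι → E) :
    ∑' i, ‖f i‖ ^ 2 = (∑' i, ‖f i‖ₑ ^ 2).toReal := by
  rw [ENNReal.tsum_toReal_eq (by simp)]
  simp

/-- `T` is a Hilbert-Schmidt operator. -/
def IsHilbertSchmidt (T : H →L[ℂ] H) : Prop :=
  ∀ (ι : Type w) (b : HilbertBasis ι ℂ H), Summable fun i ↦ ‖T (b i)‖ ^ 2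

theorem IsHilbertSchmidt.comp_left {T : H →L[ℂ] H} (h : IsHilbertSchmidt T) (W : H →L[ℂ] H) :
    IsHilbertSchmidt (W ∘L T) := by
  intro ι b
  refine ((h ι b).mul_left (‖W‖ ^ 2)).of_nonneg_of_le (fun i ↦ sq_nonneg _) fun i ↦ ?_
  rw [← mul_pow]
  exact pow_le_pow_left₀ (norm_nonneg _) (W.le_opNorm _) 2

theorem IsHilbertSchmidt.summable_norm_inner {X Y : H →L[ℂ] H} (hX : IsHilbertSchmidt X)
    (hY : IsHilbertSchmidt Y) (ι : Type w) (b : HilbertBasis ι ℂ H) :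
    Summable fun i ↦ ‖(inner ℂ (X (b i)) (Y (b i)) : ℂ)‖ := by
  refine ((hX ι b).add (hY ι b)).of_nonneg_of_le (fun i ↦ norm_nonneg _) fun i ↦ ?_
  refine (norm_inner_le_norm _ _).trans ?_
  nlinarith [sq_nonneg (‖X (b i)‖ - ‖Y (b i)‖), sq_nonneg (‖X (b i)‖), sq_nonneg (‖Y (b i)‖)]

variable [CompleteSpace H]

/-- By Parseval both sides are the double sum of `|⟨c j, T (b i)⟩|²`. As the bases are arbitrary,
this also contains the basis independence of the Hilbert-Schmidt norm. -/
theorem tsum_enorm_adjoint_sq {ι ι' : Type*} (b : HilbertBasis ι ℂ H) (c : HilbertBasis ι' ℂ H)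
    (T : H →L[ℂ] H) : ∑' j, ‖T.adjoint (c j)‖ₑ ^ 2 = ∑' i, ‖T (b i)‖ₑ ^ 2 := by
  simp_rw [← tsum_enorm_inner_sq b (T.adjoint _), ← tsum_enorm_inner_sq c (T _)]
  rw [ENNReal.tsum_comm]
  refine tsum_congr fun i ↦ tsum_congr fun j ↦ ?_
  rw [ContinuousLinearMap.adjoint_inner_right, ← inner_conj_symm, RCLike.enorm_conj]

theorem IsHilbertSchmidt.adjoint {T : H →L[ℂ] H} (h : IsHilbertSchmidt T) :
    IsHilbertSchmidt T.adjoint := by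
  intro ι b
  rw [summable_norm_sq_iff, tsum_enorm_adjoint_sq b, ← summable_norm_sq_iff]
  exact h ι b

theorem IsHilbertSchmidt.comp_right {T : H →L[ℂ] H} (h : IsHilbertSchmidt T) (W : H →L[ℂ] H) :
    IsHilbertSchmidt (T ∘L W) := by
  have := (h.adjoint.comp_left W.adjoint).adjoint
  rwa [ContinuousLinearMap.adjoint_comp, ContinuousLinearMap.adjoint_adjoint,
    ContinuousLinearMap.adjoint_adjoint] at this

/-- Douglas' lemma: an operator `S` with `‖S x‖ ≤ ‖T x‖` for all `x` factors through `T`. -/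
theorem exists_eq_comp_of_norm_le {S T : H →L[ℂ] H} (h : ∀ x, ‖S x‖ ≤ ‖T x‖) :
    ∃ W : H →L[ℂ] H, S = W ∘L T := by
  let K : Submodule ℂ H := T.range.topologicalClosure
  have hK : IsClosed (K : Set H) := Submodule.isClosed_topologicalClosure _
  have : CompleteSpace K := hK.completeSpace_coe
  have hmem : ∀ x, T x ∈ K := fun x ↦ Submodule.le_topologicalClosure _ ⟨x, rfl⟩
  let e : H →ₗ[ℂ] K := T.toLinearMap.codRestrict K hmem
  have hd : DenseRange e := by
    intro y
    have hy : (y : H) ∈ closure (Set.range T) := y.2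
    rw [Topology.IsInducing.subtypeVal.closure_eq_preimage_closure_image, Set.mem_preimage,
      ← Set.range_comp]
    exact hy
  have hn : ∀ x, ‖S.toLinearMap x‖ ≤ 1 * ‖e x‖ := fun x ↦ by
    rw [one_mul]
    exact h x
  -- `W` extends `T x ↦ S x` by continuity to the closure of the range of `T` and vanishes on its
  -- orthogonal complement.
  refine ⟨S.toLinearMap.extendOfNorm e ∘L K.orthogonalProjectionOnto, ?_⟩
  ext x
  have h1 : K.orthogonalProjectionOnto (T x) = e x :=
    Submodule.orthogonalProjectionOnto_mem_subspace_eq_self (K := K) (e x)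
  rw [ContinuousLinearMap.comp_apply, ContinuousLinearMap.comp_apply, h1,
    LinearMap.extendOfNorm_eq hd ⟨1, hn⟩]
  rfl

theorem norm_abs_apply (T : H →L[ℂ] H) (x : H) : ‖CFC.abs T x‖ = ‖T x‖ := by
  have h : (inner ℂ (CFC.abs T x) (CFC.abs T x) : ℂ) = inner ℂ (T x) (T x) := by
    rw [← ContinuousLinearMap.adjoint_inner_right, ← ContinuousLinearMap.adjoint_inner_right T,
      ← ContinuousLinearMap.star_eq_adjoint, ← ContinuousLinearMap.star_eq_adjoint,
      (CFC.abs_nonneg T).isSelfAdjoint.star_eq, ← mul_apply_eq_comp,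
      ← mul_apply_eq_comp, CFC.abs_mul_abs]
  rw [inner_self_eq_norm_sq_to_K, inner_self_eq_norm_sq_to_K] at h
  have h' : ‖CFC.abs T x‖ ^ 2 = ‖T x‖ ^ 2 := by exact_mod_cast h
  exact (pow_left_inj₀ (norm_nonneg _) (norm_nonneg _) two_ne_zero).mp h'

/-- Douglas' lemma replaces the polar decomposition: `|X*Y| = W X*Y` for some bounded `W`, so `⟨b,
|X*Y| b⟩ = ⟨X W* b, Y b⟩`, which is summable because `X W*` and `Y` are Hilbert-Schmidt. -/
theorem IsHilbertSchmidt.isTraceClass_adjoint_comp {X Y : H →L[ℂ] H} (hX : IsHilbertSchmidt X)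
    (hY : IsHilbertSchmidt Y) : IsTraceClass (X.adjoint ∘L Y) := by
  intro ι b
  obtain ⟨W, hW⟩ := exists_eq_comp_of_norm_le fun x ↦ (norm_abs_apply (X.adjoint ∘L Y) x).le
  have h := ((hX.comp_right W.adjoint).summable_norm_inner hY ι b).of_norm.mapL Complex.reCLM
  convert h using 2 with i
  rw [hW, Complex.reCLM_apply, ContinuousLinearMap.comp_apply, ContinuousLinearMap.comp_apply,
    ContinuousLinearMap.comp_apply, ← ContinuousLinearMap.adjoint_inner_left,
    ← ContinuousLinearMap.adjoint_inner_left, ContinuousLinearMap.adjoint_adjoint]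

/-- This is `tr(YX*) = tr(X*Y)`. Both sides are iterated sums of `⟨X bᵢ, cⱼ⟩⟨cⱼ, Y bᵢ⟩`, a product
of two square-summable families and hence absolutely summable, so the order of summation is free. -/
theorem IsHilbertSchmidt.tsum_inner_adjoint {X Y : H →L[ℂ] H} (hX : IsHilbertSchmidt X)
    (hY : IsHilbertSchmidt Y) {ι ι' : Type w} (b : HilbertBasis ι ℂ H) (c : HilbertBasis ι' ℂ H) :
    ∑' j, (inner ℂ (Y.adjoint (c j)) (X.adjoint (c j)) : ℂ) =
      ∑' i, (inner ℂ (X (b i)) (Y (b i)) : ℂ) := by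
  have key : ∀ {Z : H →L[ℂ] H}, IsHilbertSchmidt Z →
      Summable fun p : ι × ι' ↦ ‖(inner ℂ (c p.2) (Z (b p.1)) : ℂ)‖ ^ 2 := by
    intro Z hZ
    rw [summable_norm_sq_iff, ENNReal.tsum_prod (f := fun i j ↦ ‖(inner ℂ (c j) (Z (b i)) : ℂ)‖ₑ ^ 2)]
    simp_rw [tsum_enorm_inner_sq c]
    rw [← summable_norm_sq_iff]
    exact hZ ι b
  have hs : Summable fun p : ι × ι' ↦
      (inner ℂ (X (b p.1)) (c p.2) * inner ℂ (c p.2) (Y (b p.1)) : ℂ) := by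
    refine Summable.of_norm ?_
    refine ((key hX).add (key hY)).of_nonneg_of_le (fun i ↦ norm_nonneg _) fun p ↦ ?_
    rw [norm_mul, norm_inner_symm]
    nlinarith [sq_nonneg (‖(inner ℂ (c p.2) (X (b p.1)) : ℂ)‖ - ‖(inner ℂ (c p.2) (Y (b p.1)) : ℂ)‖),
      sq_nonneg (‖(inner ℂ (c p.2) (X (b p.1)) : ℂ)‖), sq_nonneg (‖(inner ℂ (c p.2) (Y (b p.1)) : ℂ)‖)]
  simp_rw [← c.tsum_inner_mul_inner (X _) (Y _), ← b.tsum_inner_mul_inner (Y.adjoint _) (X.adjoint _)]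
  rw [← hs.tsum_comm (f := fun i j ↦ (inner ℂ (X (b i)) (c j) * inner ℂ (c j) (Y (b i)) : ℂ))]
  refine tsum_congr fun j ↦ tsum_congr fun i ↦ ?_
  rw [ContinuousLinearMap.adjoint_inner_left, ContinuousLinearMap.adjoint_inner_right, mul_comm]

theorem IsHilbertSchmidt.hasTrace_adjoint_comp {X Y : H →L[ℂ] H} (hX : IsHilbertSchmidt X)
    (hY : IsHilbertSchmidt Y) {t : ℂ}
    (ht : ∀ (ι : Type w) (b : HilbertBasis ι ℂ H), HasSum (fun i ↦ inner ℂ (X (b i)) (Y (b i))) t) :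
    HasTrace (X.adjoint ∘L Y) t := by
  refine ⟨hX.isTraceClass_adjoint_comp hY, fun ι b ↦ ?_⟩
  simp only [ContinuousLinearMap.comp_apply, ContinuousLinearMap.adjoint_inner_right]
  exact ht ι b

theorem IsHilbertSchmidt.hasTrace_comp_adjoint {X Y : H →L[ℂ] H} (hX : IsHilbertSchmidt X)
    (hY : IsHilbertSchmidt Y) {t : ℂ}
    (ht : ∀ (ι : Type w) (b : HilbertBasis ι ℂ H), HasSum (fun i ↦ inner ℂ (X (b i)) (Y (b i))) t) :
    HasTrace (Y ∘L X.adjoint) t := by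
  have h : HasTrace (Y.adjoint.adjoint ∘L X.adjoint) t := by
    refine hY.adjoint.hasTrace_adjoint_comp hX.adjoint fun ι c ↦ ?_
    obtain ⟨s, b, -⟩ := exists_hilbertBasis ℂ H
    rw [← (ht s b).tsum_eq, ← hX.tsum_inner_adjoint hY b c]
    exact (hY.adjoint.summable_norm_inner hX.adjoint ι c).of_norm.hasSum
  rwa [ContinuousLinearMap.adjoint_adjoint] at h

theorem IsTraceClass.neg {T : H →L[ℂ] H} (h : IsTraceClass T) : IsTraceClass (-T) := by
  intro ι b
  rw [CFC.abs_neg]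
  exact h ι b

theorem HasTrace.neg {T : H →L[ℂ] H} {t : ℂ} (h : HasTrace T t) : HasTrace (-T) (-t) := by
  refine ⟨h.1.neg, fun ι b ↦ ?_⟩
  simpa using (h.2 ι b).neg

end Abstract

end BirmanSchwinger

end

noncomputable section

namespace BirmanSchwinger

/-! ### Operators on `L²(ℝ)` given by `(T f)(x) = ⟨φₓ, f⟩` -/

section PointwiseRepresentation

/-- Distinct vectors are at distance `√2`, so the balls of radius `1/2` around them are disjoint
open sets in a separable space. Countability of bases is needed because the null set in `(T f)(x) =
⟨φₓ, f⟩` depends on `f`, and to sum under the integral. -/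
theorem Orthonormal.countable {H ι : Type*} [NormedAddCommGroup H] [InnerProductSpace ℂ H]
    [TopologicalSpace.SeparableSpace H] {b : ι → H} (hb : Orthonormal ℂ b) : Countable ι := by
  have hd : ∀ i j, i ≠ j → 1 ≤ dist (b i) (b j) := by
    intro i j hij
    have h := norm_sub_sq (𝕜 := ℂ) (b i) (b j)
    rw [hb.2 hij, hb.1 i, hb.1 j, ← dist_eq_norm] at h
    norm_num at h
    nlinarith [dist_nonneg (x := b i) (y := b j)]
  have := Set.PairwiseDisjoint.countable_of_isOpen (ι := ι) (a := Set.univ)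
    (s := fun i ↦ Metric.ball (b i) (1 / 2)) ?_ (fun i _ ↦ Metric.isOpen_ball)
    (fun i _ ↦ ⟨b i, Metric.mem_ball_self (by norm_num)⟩)
  · exact Set.countable_univ_iff.mp this
  · intro i _ j _ hij
    exact Metric.ball_disjoint_ball (by linarith [hd i j hij])

theorem HilbertBasis.countable {ι : Type*} (b : HilbertBasis ι ℂ L2) : Countable ι := by
  have : Fact ((2 : ℝ≥0∞) ≠ ∞) := ⟨ENNReal.ofNat_ne_top⟩
  exact Orthonormal.countable b.orthonormal

theorem enorm_sq_eq_lintegral (f : L2) : ‖f‖ₑ ^ 2 = ∫⁻ x, ‖f x‖ₑ ^ 2 := by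
  rw [Lp.enorm_def, eLpNorm_eq_lintegral_rpow_enorm_toReal two_ne_zero ENNReal.ofNat_ne_top,
    ← ENNReal.rpow_natCast, ← ENNReal.rpow_mul]
  norm_num

theorem norm_sq_eq_integral (f : L2) : ‖f‖ ^ 2 = ∫ x, ‖f x‖ ^ 2 := by
  rw [integral_eq_lintegral_of_nonneg_ae (Filter.Eventually.of_forall fun x ↦ sq_nonneg _)
    ((Lp.aestronglyMeasurable f).norm.pow 2)]
  simp only [ENNReal.ofReal_pow (norm_nonneg _), ofReal_norm]
  rw [← enorm_sq_eq_lintegral]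
  simp

theorem tsum_enorm_sq_eq_lintegral {T : L2 →L[ℂ] L2} {φ : ℝ → L2}
    (h : ∀ f, ∀ᵐ x, (T f) x = inner ℂ (φ x) f) {ι : Type*} (b : HilbertBasis ι ℂ L2) :
    ∑' i, ‖T (b i)‖ₑ ^ 2 = ∫⁻ x, ‖φ x‖ₑ ^ 2 := by
  have := HilbertBasis.countable b
  simp only [enorm_sq_eq_lintegral (T _)]
  rw [← lintegral_tsum fun i ↦ (Lp.aestronglyMeasurable _).enorm.pow_const 2]
  refine lintegral_congr_ae ?_
  filter_upwards [ae_all_iff.mpr fun i ↦ h (b i)] with x hx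
  rw [← tsum_enorm_inner_sq b (φ x)]
  refine tsum_congr fun i ↦ ?_
  rw [hx, ← inner_conj_symm, RCLike.enorm_conj]

theorem IsHilbertSchmidt.of_representation {T : L2 →L[ℂ] L2} {φ : ℝ → L2}
    (h : ∀ f, ∀ᵐ x, (T f) x = inner ℂ (φ x) f) (hφ : ∫⁻ x, ‖φ x‖ₑ ^ 2 ≠ ∞) :
    IsHilbertSchmidt T := by
  intro ι b
  rw [summable_norm_sq_iff, tsum_enorm_sq_eq_lintegral h b]
  exact hφ

/-- Pointwise, `∑ᵢ ⟨bᵢ, φₓ⟩⟨ψₓ, bᵢ⟩ = ⟨ψₓ, φₓ⟩` by Parseval. Summing under the integral is allowed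
because the integrals of the norms are bounded by `‖S bᵢ‖² + ‖T bᵢ‖²`. -/
theorem hasSum_inner_of_representation {S T : L2 →L[ℂ] L2} {φ ψ : ℝ → L2}
    (hS : ∀ f, ∀ᵐ x, (S f) x = inner ℂ (φ x) f) (hT : ∀ f, ∀ᵐ x, (T f) x = inner ℂ (ψ x) f)
    (hφ : ∫⁻ x, ‖φ x‖ₑ ^ 2 ≠ ∞) (hψ : ∫⁻ x, ‖ψ x‖ₑ ^ 2 ≠ ∞)
    {ι : Type} (b : HilbertBasis ι ℂ L2) :
    HasSum (fun i ↦ (inner ℂ (S (b i)) (T (b i)) : ℂ)) (∫ x, inner ℂ (ψ x) (φ x)) := by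
  have := HilbertBasis.countable b
  have hint : ∀ i, Integrable fun x ↦ (inner ℂ ((S (b i)) x) ((T (b i)) x) : ℂ) :=
    fun i ↦ L2.integrable_inner _ _
  have hsq : ∀ f : L2, Integrable fun x ↦ ‖f x‖ ^ 2 :=
    fun f ↦ (Lp.memLp f).integrable_norm_pow two_ne_zero
  have hsum : Summable fun i ↦ ∫ x, ‖(inner ℂ ((S (b i)) x) ((T (b i)) x) : ℂ)‖ := by
    refine ((IsHilbertSchmidt.of_representation hS hφ ι b).add
      (IsHilbertSchmidt.of_representation hT hψ ι b)).of_nonneg_of_le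
      (fun i ↦ integral_nonneg fun x ↦ norm_nonneg _) fun i ↦ ?_
    rw [norm_sq_eq_integral, norm_sq_eq_integral, ← integral_add (hsq _) (hsq _)]
    refine integral_mono (hint i).norm ((hsq _).add (hsq _)) fun x ↦ ?_
    refine (norm_inner_le_norm _ _).trans ?_
    nlinarith [sq_nonneg (‖(S (b i)) x‖ - ‖(T (b i)) x‖), sq_nonneg ‖(S (b i)) x‖,
      sq_nonneg ‖(T (b i)) x‖]
  have key := hasSum_integral_of_summable_integral_norm hint hsum
  have e : ∫ x, (inner ℂ (ψ x) (φ x) : ℂ) =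
      ∫ x, ∑' i, (inner ℂ ((S (b i)) x) ((T (b i)) x) : ℂ) := by
    refine integral_congr_ae ?_
    filter_upwards [ae_all_iff.mpr fun i ↦ hS (b i), ae_all_iff.mpr fun i ↦ hT (b i)] with x h1 h2
    rw [← b.tsum_inner_mul_inner]
    refine tsum_congr fun i ↦ ?_
    rw [h1, h2, RCLike.inner_apply, inner_conj_symm]
  rw [e]
  simp only [L2.inner_def]
  exact key

end PointwiseRepresentation

end BirmanSchwinger

end

noncomputable section

namespace BirmanSchwinger

/-! ### The `L²` Fourier transform, its integral formula, and Fourier multipliers -/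

section Fourier

/-- The abstract transform on `L²` agrees with the integral on `L¹ ∩ L²`: tested against a smooth
compactly supported function, either one can be moved onto the test function, by duality of
distributions or by Fubini. -/
theorem fourierInv_ae_eq {h : L2} (hh : Integrable h) :
    (𝓕⁻ h : L2) =ᵐ[volume] 𝓕⁻ (h : ℝ → ℂ) := by
  have hcont : Continuous (𝓕⁻ (h : ℝ → ℂ)) := by
    have := VectorFourier.fourierIntegral_continuous Real.continuous_fourierChar
      (L := -innerₗ ℝ) (by fun_prop) hh
    exact this
  refine ae_eq_of_integral_contDiff_smul_eq ((Lp.memLp _).locallyIntegrable one_le_two)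
    hcont.locallyIntegrable ?_
  intro g g_smooth g_cpt
  have hg₁ : HasCompactSupport (Complex.ofRealCLM ∘ g) := g_cpt.comp_left rfl
  have hg₂ : ContDiff ℝ (⊤ : ℕ∞) (Complex.ofRealCLM ∘ g) := by fun_prop
  let G : 𝓢(ℝ, ℂ) := hg₁.toSchwartzMap hg₂
  have h1 : toDistr (𝓕⁻ h) G = ∫ x, (𝓕⁻ G) x • h x := by
    have := Lp.fourierInv_toTemperedDistribution_eq h
    have h2 := congrArg (fun T : 𝓢'(ℝ, ℂ) ↦ T G) this
    simp only [TemperedDistribution.fourierInv_apply, Lp.toTemperedDistribution_apply] at h2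
    rw [h2]
    simp
  have h3 : ∫ x, (𝓕⁻ G) x • h x = ∫ x, G x • 𝓕⁻ (h : ℝ → ℂ) x := by
    -- The sign in `-innerₗ ℝ` selects the inverse transform.
    have := VectorFourier.integral_fourierIntegral_smul_eq_flip (L := -innerₗ ℝ)
      Real.continuous_fourierChar (by fun_prop) (G.integrable (μ := volume)) hh
    have hflip : (-innerₗ ℝ).flip = -innerₗ ℝ := by
      ext
      simp
    rw [hflip] at this
    rw [SchwartzMap.fourierInv_coe]
    exact this
  have h4 : toDistr (𝓕⁻ h) G = ∫ x, G x • (𝓕⁻ h : L2) x := by simp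
  rw [h4, h3] at h1
  exact h1

theorem fourier_ae_eq {h : L2} (hh : Integrable h) :
    (𝓕 h : L2) =ᵐ[volume] 𝓕 (h : ℝ → ℂ) := by
  have hcont : Continuous (𝓕 (h : ℝ → ℂ)) := by
    have := VectorFourier.fourierIntegral_continuous Real.continuous_fourierChar
      (L := innerₗ ℝ) (by fun_prop) hh
    exact this
  refine ae_eq_of_integral_contDiff_smul_eq ((Lp.memLp _).locallyIntegrable one_le_two)
    hcont.locallyIntegrable ?_
  intro g g_smooth g_cpt
  have hg₁ : HasCompactSupport (Complex.ofRealCLM ∘ g) := g_cpt.comp_left rfl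
  have hg₂ : ContDiff ℝ (⊤ : ℕ∞) (Complex.ofRealCLM ∘ g) := by fun_prop
  let G : 𝓢(ℝ, ℂ) := hg₁.toSchwartzMap hg₂
  have h1 : toDistr (𝓕 h) G = ∫ x, (𝓕 G) x • h x := by
    have := Lp.fourier_toTemperedDistribution_eq h
    have h2 := congrArg (fun T : 𝓢'(ℝ, ℂ) ↦ T G) this
    simp only [TemperedDistribution.fourier_apply, Lp.toTemperedDistribution_apply] at h2
    rw [h2]
    simp
  have h3 : ∫ x, (𝓕 G) x • h x = ∫ x, G x • 𝓕 (h : ℝ → ℂ) x := by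
    have := VectorFourier.integral_fourierIntegral_smul_eq_flip (L := innerₗ ℝ)
      Real.continuous_fourierChar (by fun_prop) (G.integrable (μ := volume)) hh
    have hflip : (innerₗ ℝ).flip = innerₗ ℝ := by
      ext
      simp
    rw [hflip] at this
    rw [SchwartzMap.fourier_coe]
    exact this
  have h4 : toDistr (𝓕 h) G = ∫ x, G x • (𝓕 h : L2) x := by simp
  rw [h4, h3] at h1
  exact h1

/-- The Fourier multiplier with symbol `m`. -/
def multiplier (m : ℝ → ℂ) (hm : MemLp m ∞ volume) : L2 →L[ℂ] L2 :=
  (Lp.fourierTransformₗᵢ ℝ ℂ).symm.toContinuousLinearEquiv.toContinuousLinearMap ∘L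
    mulOp m hm ∘L (Lp.fourierTransformₗᵢ ℝ ℂ).toContinuousLinearEquiv.toContinuousLinearMap

theorem multiplier_apply (m : ℝ → ℂ) (hm : MemLp m ∞ volume) (f : L2) :
    multiplier m hm f = 𝓕⁻ (mulOp m hm (𝓕 f)) := rfl

theorem fourier_multiplier (m : ℝ → ℂ) (hm : MemLp m ∞ volume) (f : L2) :
    𝓕 (multiplier m hm f) = mulOp m hm (𝓕 f) := by
  rw [multiplier_apply, FourierTransform.fourier_fourierInv_eq]

theorem integrable_mulOp {m : ℝ → ℂ} (hm : MemLp m ∞ volume) (hm2 : MemLp m 2 volume) (f : L2) :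
    Integrable (mulOp m hm f) :=
  (MemLp.integrable_mul hm2 (Lp.memLp f)).congr (coeFn_mulOp m hm f).symm

theorem inner_mulOp_left {m n : ℝ → ℂ} (hm : MemLp m ∞ volume) (hn : MemLp n ∞ volume)
    (h : ∀ x, n x = starRingEnd ℂ (m x)) (f g : L2) :
    (inner ℂ (mulOp m hm f) g : ℂ) = inner ℂ f (mulOp n hn g) := by
  rw [L2.inner_def, L2.inner_def]
  refine integral_congr_ae ?_
  filter_upwards [coeFn_mulOp m hm f, coeFn_mulOp n hn g] with x h1 h2
  rw [h1, h2, RCLike.inner_apply, RCLike.inner_apply, h, map_mul]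
  ring

theorem mulOp_comp_mulOp {m n p : ℝ → ℂ} (hm : MemLp m ∞ volume) (hn : MemLp n ∞ volume)
    (hp : MemLp p ∞ volume) (h : ∀ x, m x * n x = p x) (f : L2) :
    mulOp m hm (mulOp n hn f) = mulOp p hp f := by
  refine Lp.ext ?_
  filter_upwards [coeFn_mulOp m hm (mulOp n hn f), coeFn_mulOp n hn f, coeFn_mulOp p hp f]
    with x h1 h2 h3
  rw [h1, h2, h3, ← mul_assoc, h]

theorem inner_multiplier_left {m : ℝ → ℂ} (hm : MemLp m ∞ volume)
    (h : ∀ x, m x = starRingEnd ℂ (m x)) (f g : L2) :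
    (inner ℂ (multiplier m hm f) g : ℂ) = inner ℂ f (multiplier m hm g) := by
  rw [← Lp.inner_fourier_eq, ← Lp.inner_fourier_eq f, fourier_multiplier, fourier_multiplier,
    inner_mulOp_left hm hm h]

theorem memLp_twist {m : ℝ → ℂ} (hm : MemLp m 2 volume) (x : ℝ) :
    MemLp (fun ξ ↦ starRingEnd ℂ ((Real.fourierChar (ξ * x) : ℂ) * m ξ)) 2 volume := by
  refine hm.of_le ?_ (Filter.Eventually.of_forall fun ξ ↦ ?_)
  · refine (Complex.continuous_conj.comp_aestronglyMeasurable ?_)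
    refine AEStronglyMeasurable.mul ?_ hm.1
    have := Real.continuous_fourierChar
    exact Continuous.aestronglyMeasurable (by fun_prop)
  · rw [RCLike.norm_conj, norm_mul, Circle.norm_coe, one_mul]

/-- The function `ξ ↦ conj (e^{2πi ξ x} m(ξ))` in `L²(ℝ)`. -/
def twist (m : ℝ → ℂ) (hm : MemLp m 2 volume) (x : ℝ) : L2 :=
  (memLp_twist hm x).toLp _

theorem coeFn_twist {m : ℝ → ℂ} (hm : MemLp m 2 volume) (x : ℝ) :
    twist m hm x =ᵐ[volume] fun ξ ↦ starRingEnd ℂ ((Real.fourierChar (ξ * x) : ℂ) * m ξ) :=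
  MemLp.coeFn_toLp _

/-- As `m` and `f` are in `L²`, their product is integrable, so its inverse transform is an honest
integral of `e^{2πiξx} m(ξ) f(ξ)`. The conjugate in `twist` undoes the one in the inner product. -/
theorem fourierInv_mulOp_ae_eq {m : ℝ → ℂ} (hm : MemLp m ∞ volume) (hm2 : MemLp m 2 volume)
    (f : L2) : ∀ᵐ x, (𝓕⁻ (mulOp m hm f) : L2) x = inner ℂ (twist m hm2 x) f := by
  filter_upwards [fourierInv_ae_eq (integrable_mulOp hm hm2 f)] with x hx
  rw [hx, Real.fourierInv_eq, L2.inner_def]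
  refine integral_congr_ae ?_
  filter_upwards [coeFn_mulOp m hm f, coeFn_twist hm2 x] with ξ h1 h2
  rw [h1, h2, RCLike.inner_apply, RCLike.inner_apply, Complex.conj_conj, Circle.smul_def,
    smul_eq_mul, conj_trivial, mul_comm x ξ]
  ring

theorem fourier_mulOp_ae_eq {m : ℝ → ℂ} (hm : MemLp m ∞ volume) (hm2 : MemLp m 2 volume)
    (f : L2) : ∀ᵐ ξ, (𝓕 (mulOp m hm f) : L2) ξ = inner ℂ (twist m hm2 (-ξ)) f := by
  filter_upwards [fourier_ae_eq (integrable_mulOp hm hm2 f)] with x hx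
  rw [hx, Real.fourier_eq, L2.inner_def]
  refine integral_congr_ae ?_
  filter_upwards [coeFn_mulOp m hm f, coeFn_twist hm2 (-x)] with ξ h1 h2
  rw [h1, h2, RCLike.inner_apply, RCLike.inner_apply, Complex.conj_conj, Circle.smul_def,
    smul_eq_mul, conj_trivial, mul_comm x ξ, mul_neg]
  ring

theorem enorm_twist_sq {m : ℝ → ℂ} (hm : MemLp m 2 volume) (x : ℝ) :
    ‖twist m hm x‖ₑ ^ 2 = ∫⁻ ξ, ‖m ξ‖ₑ ^ 2 := by
  rw [enorm_sq_eq_lintegral]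
  refine lintegral_congr_ae ?_
  filter_upwards [coeFn_twist hm x] with ξ h
  rw [h, ← ofReal_norm, RCLike.norm_conj, norm_mul, Circle.norm_coe, one_mul, ofReal_norm]

theorem fourier_twist_ae_eq {m : ℝ → ℂ} (hm1 : Integrable m) (hm : MemLp m 2 volume) (x : ℝ) :
    ∀ᵐ ξ, (𝓕 (twist m hm x) : L2) ξ = starRingEnd ℂ (𝓕 m (-x - ξ)) := by
  have hi : Integrable (twist m hm x) := by
    have h2 : Integrable (fun ξ ↦ starRingEnd ℂ ((Real.fourierChar (ξ * x) : ℂ) * m ξ)) := by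
      refine hm1.mono (memLp_twist hm x).1 (Filter.Eventually.of_forall fun ξ ↦ ?_)
      rw [RCLike.norm_conj, norm_mul, Circle.norm_coe, one_mul]
    exact h2.congr (coeFn_twist hm x).symm
  filter_upwards [fourier_ae_eq hi] with ξ hξ
  rw [hξ, Real.fourier_eq, Real.fourier_eq, ← integral_conj]
  refine integral_congr_ae ?_
  filter_upwards [coeFn_twist hm x] with y hy
  rw [hy, Circle.smul_def, Circle.smul_def, smul_eq_mul, smul_eq_mul,
    map_mul (starRingEnd ℂ), map_mul (starRingEnd ℂ), ← mul_assoc,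
    ← Circle.coe_inv_eq_conj, ← Circle.coe_inv_eq_conj, ← Circle.coe_mul,
    ← AddChar.map_neg_eq_inv, ← AddChar.map_neg_eq_inv, ← AddChar.map_add_eq_mul]
  congr 4
  simp only [RCLike.inner_apply, conj_trivial]
  ring

end Fourier

end BirmanSchwinger

end

noncomputable section

namespace BirmanSchwinger

/-! ### The integrals of the resolvent symbol -/

section Integrals

theorem integrable_inv_sq_add_sq {κ : ℝ} (hκ : 0 < κ) : Integrable fun p : ℝ ↦ (p ^ 2 + κ ^ 2)⁻¹ := by
  have h := (integrable_inv_one_add_sq.comp_div hκ.ne').const_mul (κ ^ 2)⁻¹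
  refine h.congr (Filter.Eventually.of_forall fun p ↦ ?_)
  dsimp only
  rw [← mul_inv]
  congr 1
  field_simp
  ring

theorem integral_inv_sq_add_sq {κ : ℝ} (hκ : 0 < κ) : ∫ p : ℝ, (p ^ 2 + κ ^ 2)⁻¹ = π / κ := by
  have h : ∀ p : ℝ, (p ^ 2 + κ ^ 2)⁻¹ = (κ ^ 2)⁻¹ * (1 + (p / κ) ^ 2)⁻¹ := by
    intro p
    rw [← mul_inv]
    congr 1
    field_simp
    ring
  simp only [h]
  rw [integral_const_mul, Measure.integral_comp_div (fun p : ℝ ↦ (1 + p ^ 2)⁻¹),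
    integral_univ_inv_one_add_sq, abs_of_pos hκ, smul_eq_mul]
  field_simp

/-- Partial fractions, arranged so that the last bracket is the derivative of `log (p² + κ²) - log
((p - q)² + κ²)` and contributes nothing to the integral over `ℝ`. -/
theorem inv_sq_add_sq_mul_eq {κ q : ℝ} (hκ : 0 < κ) (hq : q ≠ 0) (p : ℝ) :
    (q ^ 2 + 4 * κ ^ 2) * ((p ^ 2 + κ ^ 2)⁻¹ * ((p - q) ^ 2 + κ ^ 2)⁻¹) =
      (p ^ 2 + κ ^ 2)⁻¹ + ((p - q) ^ 2 + κ ^ 2)⁻¹ +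
      q⁻¹ * (2 * p / (p ^ 2 + κ ^ 2) - 2 * (p - q) / ((p - q) ^ 2 + κ ^ 2)) := by
  have h1 : p ^ 2 + κ ^ 2 ≠ 0 := by positivity
  have h2 : (p - q) ^ 2 + κ ^ 2 ≠ 0 := by positivity
  field_simp
  ring

theorem integrable_inv_sq_add_sq_mul {κ : ℝ} (hκ : 0 < κ) (q : ℝ) :
    Integrable fun p : ℝ ↦ (p ^ 2 + κ ^ 2)⁻¹ * ((p - q) ^ 2 + κ ^ 2)⁻¹ := by
  refine (integrable_inv_sq_add_sq hκ).mul_bdd (c := (κ ^ 2)⁻¹) ?_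
    (Filter.Eventually.of_forall fun p ↦ ?_)
  · exact ((integrable_inv_sq_add_sq hκ).comp_sub_right q).1
  · rw [Real.norm_of_nonneg (by positivity)]
    exact inv_anti₀ (by positivity) (by nlinarith [sq_nonneg (p - q)])

/-- A factor `p²` cancels between the two logarithms, and what remains depends continuously on `p⁻¹`
near `0`. The general filter covers both ends of the line. -/
theorem tendsto_log_sub_log (κ q : ℝ) (l : Filter ℝ)
    (hl : Filter.Tendsto (fun p : ℝ ↦ p⁻¹) l (nhds 0)) (hl0 : ∀ᶠ p in l, p ≠ 0) (hκ : 0 < κ) :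
    Filter.Tendsto (fun p ↦ Real.log (p ^ 2 + κ ^ 2) - Real.log ((p - q) ^ 2 + κ ^ 2)) l (nhds 0) := by
  have h : Filter.Tendsto (fun p : ℝ ↦ Real.log (1 + κ ^ 2 * (p⁻¹) ^ 2) -
      Real.log ((1 - q * p⁻¹) ^ 2 + κ ^ 2 * (p⁻¹) ^ 2)) l
      (nhds (Real.log (1 + κ ^ 2 * 0 ^ 2) - Real.log ((1 - q * 0) ^ 2 + κ ^ 2 * 0 ^ 2))) := by
    refine ((((hl.pow 2).const_mul _).const_add _).log (by simp)).sub
      (((((hl.const_mul q).const_sub 1).pow 2).add ((hl.pow 2).const_mul _)).log (by simp))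
  simp only [ne_eq, OfNat.ofNat_ne_zero, not_false_eq_true, zero_pow, mul_zero, add_zero, sub_zero,
    one_pow, sub_self] at h
  refine h.congr' ?_
  filter_upwards [hl0] with p hp
  have e1 : 1 + κ ^ 2 * (p⁻¹) ^ 2 = (p ^ 2 + κ ^ 2) / p ^ 2 := by field_simp
  have e2 : (1 - q * p⁻¹) ^ 2 + κ ^ 2 * (p⁻¹) ^ 2 = ((p - q) ^ 2 + κ ^ 2) / p ^ 2 := by field_simp
  rw [e1, e2, Real.log_div (by positivity) (by positivity),
    Real.log_div (by positivity) (by positivity)]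
  ring

theorem integral_inv_sq_add_sq_mul {κ q : ℝ} (hκ : 0 < κ) (hq : q ≠ 0) :
    ∫ p : ℝ, (p ^ 2 + κ ^ 2)⁻¹ * ((p - q) ^ 2 + κ ^ 2)⁻¹ = 2 * π / κ / (q ^ 2 + 4 * κ ^ 2) := by
  have hI1 := integrable_inv_sq_add_sq hκ
  have hI2 := hI1.comp_sub_right q
  have hI := (integrable_inv_sq_add_sq_mul hκ q).const_mul (q ^ 2 + 4 * κ ^ 2)
  set D : ℝ → ℝ := fun p ↦ 2 * p / (p ^ 2 + κ ^ 2) - 2 * (p - q) / ((p - q) ^ 2 + κ ^ 2) with hD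
  -- The two fractions in `D` are not integrable separately; integrability of the difference is read
  -- off from the partial fraction identity, where every other term is integrable.
  have hDint : Integrable D := by
    refine (((hI.sub hI1).sub hI2).const_mul q).congr (Filter.Eventually.of_forall fun p ↦ ?_)
    have := inv_sq_add_sq_mul_eq hκ hq p
    simp only [Pi.sub_apply]
    rw [this]
    simp only [hD]
    field_simp
    ring
  have hD0 : ∫ p, D p = 0 := by
    have hder : ∀ p : ℝ, HasDerivAt
        (fun p ↦ Real.log (p ^ 2 + κ ^ 2) - Real.log ((p - q) ^ 2 + κ ^ 2)) (D p) p := by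
      intro p
      have h1 : HasDerivAt (fun p : ℝ ↦ p ^ 2 + κ ^ 2) (2 * p) p := by
        simpa using (hasDerivAt_pow 2 p).add_const (κ ^ 2)
      have h2 : HasDerivAt (fun p : ℝ ↦ (p - q) ^ 2 + κ ^ 2) (2 * (p - q)) p := by
        simpa using (((hasDerivAt_id p).sub_const q).pow 2).add_const (κ ^ 2)
      exact (h1.log (by positivity)).sub (h2.log (by positivity))
    have := integral_of_hasDerivAt_of_tendsto hder hDint
      (tendsto_log_sub_log κ q Filter.atBot tendsto_inv_atBot_zero
        (Filter.eventually_ne_atBot 0) hκ)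
      (tendsto_log_sub_log κ q Filter.atTop tendsto_inv_atTop_zero
        (Filter.eventually_ne_atTop 0) hκ)
    rw [this, sub_zero]
  have key : (q ^ 2 + 4 * κ ^ 2) * ∫ p : ℝ, (p ^ 2 + κ ^ 2)⁻¹ * ((p - q) ^ 2 + κ ^ 2)⁻¹ =
      2 * π / κ := by
    have e : ∀ p, (q ^ 2 + 4 * κ ^ 2) * ((p ^ 2 + κ ^ 2)⁻¹ * ((p - q) ^ 2 + κ ^ 2)⁻¹) =
        ((p ^ 2 + κ ^ 2)⁻¹ + ((p - q) ^ 2 + κ ^ 2)⁻¹) + q⁻¹ * D p := inv_sq_add_sq_mul_eq hκ hq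
    rw [← integral_const_mul]
    simp only [e]
    rw [integral_add (f := fun p ↦ (p ^ 2 + κ ^ 2)⁻¹ + ((p - q) ^ 2 + κ ^ 2)⁻¹) (hI1.add hI2)
      (hDint.const_mul _), integral_add hI1 hI2, integral_const_mul,
      hD0, integral_sub_right_eq_self (fun p : ℝ ↦ (p ^ 2 + κ ^ 2)⁻¹), integral_inv_sq_add_sq hκ]
    ring
  rw [eq_div_iff (by positivity), mul_comm, key]

theorem den_eq (κ ξ : ℝ) : (2 * π) ^ 2 * ‖ξ‖ ^ 2 + κ ^ 2 = (2 * π * ξ) ^ 2 + κ ^ 2 := by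
  rw [Real.norm_eq_abs, sq_abs]
  ring

/-- The substitution `p = 2πξ` gives `(2π)⁻¹ · π/κ`, the value on the diagonal of the Green's
function `e^{-κ|x-y|}/(2κ)`. -/
theorem lintegral_symbol {κ : ℝ} (hκ : 0 < κ) :
    ∫⁻ ξ : ℝ, ENNReal.ofReal ((2 * π) ^ 2 * ‖ξ‖ ^ 2 + κ ^ 2)⁻¹ = ENNReal.ofReal (1 / (2 * κ)) := by
  have hp := Real.two_pi_pos
  simp only [den_eq]
  have hi := (integrable_inv_sq_add_sq hκ).comp_mul_left' hp.ne'
  rw [← ofReal_integral_eq_lintegral_ofReal hi (Filter.Eventually.of_forall fun ξ ↦ by positivity),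
    Measure.integral_comp_mul_left (fun p : ℝ ↦ (p ^ 2 + κ ^ 2)⁻¹), integral_inv_sq_add_sq hκ,
    abs_of_pos (by positivity), smul_eq_mul]
  congr 1
  field_simp

theorem lintegral_symbol_mul_symbol {κ : ℝ} (hκ : 0 < κ) {ζ : ℝ} (hζ : ζ ≠ 0) :
    ∫⁻ ξ : ℝ, ENNReal.ofReal ((2 * π) ^ 2 * ‖ξ‖ ^ 2 + κ ^ 2)⁻¹ *
      ENNReal.ofReal ((2 * π) ^ 2 * ‖ξ - ζ‖ ^ 2 + κ ^ 2)⁻¹ =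
      ENNReal.ofReal (1 / κ * ((2 * π * ζ) ^ 2 + 4 * κ ^ 2)⁻¹) := by
  have hp := Real.two_pi_pos
  have hq : 2 * π * ζ ≠ 0 := mul_ne_zero hp.ne' hζ
  have hi := (integrable_inv_sq_add_sq_mul hκ (2 * π * ζ)).comp_mul_left' hp.ne'
  simp only [den_eq, mul_sub]
  simp_rw [← ENNReal.ofReal_mul (inv_nonneg.mpr (add_nonneg (sq_nonneg (2 * π * _)) (sq_nonneg κ)))]
  rw [← ofReal_integral_eq_lintegral_ofReal hi (Filter.Eventually.of_forall fun ξ ↦ by positivity),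
    Measure.integral_comp_mul_left
      (fun p : ℝ ↦ (p ^ 2 + κ ^ 2)⁻¹ * ((p - 2 * π * ζ) ^ 2 + κ ^ 2)⁻¹),
    integral_inv_sq_add_sq_mul hκ hq, abs_of_pos (by positivity), smul_eq_mul]
  congr 1
  field_simp

theorem unitaryFourier_eq (f : ℝ → ℂ) (ζ : ℝ) :
    unitaryFourier f (2 * π * ζ) = ((√(2 * π))⁻¹ : ℝ) * 𝓕 f ζ := by
  rw [unitaryFourier, Real.fourier_real_eq_integral_exp_smul]
  congr 1
  refine integral_congr_ae (Filter.Eventually.of_forall fun x ↦ ?_)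
  dsimp only
  rw [smul_eq_mul]
  congr 2
  push_cast
  ring

/-- Under `η = 2πζ` the Jacobian `2π` cancels the square of the normalization `(2π)^{-1/2}`. -/
theorem integral_unitaryFourier (f : ℝ → ℂ) (κ : ℝ) :
    ∫ η : ℝ, ‖unitaryFourier f η‖ ^ 2 / (η ^ 2 + 4 * κ ^ 2) =
      ∫ ζ : ℝ, ‖𝓕 f ζ‖ ^ 2 * ((2 * π * ζ) ^ 2 + 4 * κ ^ 2)⁻¹ := by
  have hp := Real.two_pi_pos
  have h := Measure.integral_comp_mul_left
    (fun η : ℝ ↦ ‖unitaryFourier f η‖ ^ 2 / (η ^ 2 + 4 * κ ^ 2)) (2 * π)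
  rw [abs_of_pos (by positivity), smul_eq_mul, eq_inv_mul_iff_mul_eq₀ hp.ne', ← integral_const_mul]
    at h
  rw [← h]
  refine integral_congr_ae (Filter.Eventually.of_forall fun ζ ↦ ?_)
  dsimp only
  rw [unitaryFourier_eq, norm_mul, norm_real, Real.norm_of_nonneg (by positivity), mul_pow, inv_pow,
    Real.sq_sqrt hp.le]
  field_simp

end Integrals

end BirmanSchwinger

end

noncomputable section

namespace BirmanSchwinger

/-! ### The square root of the free resolvent as a Fourier multiplier -/

section SquareRoot

/-- The symbol `((2πξ)² + κ²)^{-1/2}` of `(H₀ + κ²)^{-1/2}`. -/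
def sqrtSymbol (κ : ℝ) (ξ : ℝ) : ℂ := (√((2 * π) ^ 2 * ‖ξ‖ ^ 2 + κ ^ 2)⁻¹ : ℝ)

theorem conj_sqrtSymbol (κ ξ : ℝ) : sqrtSymbol κ ξ = starRingEnd ℂ (sqrtSymbol κ ξ) :=
  (conj_ofReal _).symm

theorem sqrtSymbol_mul_self {κ : ℝ} (hκ : 0 < κ) (ξ : ℝ) :
    sqrtSymbol κ ξ * sqrtSymbol κ ξ = resolventSymbol κ ξ := by
  rw [sqrtSymbol, resolventSymbol, ← ofReal_mul,
    Real.mul_self_sqrt (inv_nonneg.mpr (den_pos hκ ξ).le)]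

theorem norm_sqrtSymbol_sq {κ : ℝ} (hκ : 0 < κ) (ξ : ℝ) :
    ‖sqrtSymbol κ ξ‖ ^ 2 = ((2 * π) ^ 2 * ‖ξ‖ ^ 2 + κ ^ 2)⁻¹ := by
  rw [sqrtSymbol, norm_real, Real.norm_of_nonneg (Real.sqrt_nonneg _),
    Real.sq_sqrt (inv_nonneg.mpr (den_pos hκ ξ).le)]

theorem enorm_sqrtSymbol_sq {κ : ℝ} (hκ : 0 < κ) (ξ : ℝ) :
    ‖sqrtSymbol κ ξ‖ₑ ^ 2 = ENNReal.ofReal ((2 * π) ^ 2 * ‖ξ‖ ^ 2 + κ ^ 2)⁻¹ := by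
  rw [← norm_sqrtSymbol_sq hκ, ENNReal.ofReal_pow (norm_nonneg _), ofReal_norm]

theorem continuous_sqrtSymbol {κ : ℝ} (hκ : 0 < κ) : Continuous (sqrtSymbol κ) := by
  refine continuous_ofReal.comp (Real.continuous_sqrt.comp ?_)
  exact Continuous.inv₀ (by fun_prop) fun ξ ↦ (den_pos hκ ξ).ne'

theorem memLp_top_sqrtSymbol {κ : ℝ} (hκ : 0 < κ) : MemLp (sqrtSymbol κ) ∞ volume := by
  refine memLp_top_of_bound (C := κ⁻¹) (continuous_sqrtSymbol hκ).aestronglyMeasurable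
    (Filter.Eventually.of_forall fun ξ ↦ ?_)
  refine le_of_sq_le_sq ?_ (by positivity)
  rw [norm_sqrtSymbol_sq hκ, inv_pow]
  exact inv_anti₀ (by positivity) (by nlinarith [mul_nonneg (sq_nonneg (2 * π)) (sq_nonneg ‖ξ‖)])

theorem memLp_two_sqrtSymbol {κ : ℝ} (hκ : 0 < κ) : MemLp (sqrtSymbol κ) 2 volume := by
  rw [memLp_two_iff_integrable_sq_norm (continuous_sqrtSymbol hκ).aestronglyMeasurable]
  simp only [norm_sqrtSymbol_sq hκ, den_eq]
  exact (integrable_inv_sq_add_sq hκ).comp_mul_left' Real.two_pi_pos.ne'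

theorem multiplier_sqrtSymbol_nonneg {κ : ℝ} (hκ : 0 < κ) :
    0 ≤ multiplier (sqrtSymbol κ) (memLp_top_sqrtSymbol hκ) := by
  rw [ContinuousLinearMap.nonneg_iff_isPositive, ContinuousLinearMap.isPositive_iff_complex]
  intro f
  have h : inner ℂ (multiplier (sqrtSymbol κ) (memLp_top_sqrtSymbol hκ) f) f =
      ((∫ ξ, √((2 * π) ^ 2 * ‖ξ‖ ^ 2 + κ ^ 2)⁻¹ * ‖(𝓕 f : L2) ξ‖ ^ 2 : ℝ) : ℂ) := by
    rw [← Lp.inner_fourier_eq, fourier_multiplier, L2.inner_def, ← integral_complex_ofReal]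
    apply integral_congr_ae
    filter_upwards [coeFn_mulOp (sqrtSymbol κ) (memLp_top_sqrtSymbol hκ) (𝓕 f)] with ξ hξ
    rw [hξ, RCLike.inner_apply, map_mul, sqrtSymbol, conj_ofReal, mul_left_comm, mul_conj,
      normSq_eq_norm_sq, ofReal_mul]
  rw [h]
  refine ⟨by simp, ?_⟩
  rw [RCLike.re_eq_complex_re, ofReal_re]
  exact integral_nonneg fun ξ ↦ mul_nonneg (Real.sqrt_nonneg _) (by positivity)

theorem freeResolvent_eq {κ : ℝ} (hκ : 0 < κ) (f : L2) :
    freeResolvent κ f = multiplier (sqrtSymbol κ) (memLp_top_sqrtSymbol hκ)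
      (multiplier (sqrtSymbol κ) (memLp_top_sqrtSymbol hκ) f) := by
  rw [freeResolvent, (isResolvent_multiplierResolvent hκ).resolventOp_eq, multiplierResolvent_apply,
    multiplier_apply, fourier_multiplier,
    mulOp_comp_mulOp _ _ (memLp_resolventSymbol hκ) (sqrtSymbol_mul_self hκ)]

/-- A nonnegative operator whose square is the resolvent must be its square root, by uniqueness. -/
theorem freeResolventSqrt_eq {κ : ℝ} (hκ : 0 < κ) :
    freeResolventSqrt κ = multiplier (sqrtSymbol κ) (memLp_top_sqrtSymbol hκ) := by
  refine CFC.sqrt_unique ?_ (multiplier_sqrtSymbol_nonneg hκ)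
  ext1 f
  rw [freeResolvent_eq hκ]
  rfl

end SquareRoot

/-! ### Representing vectors of `v (H₀ + κ²)^{-1/2}` and `u (H₀ + κ²)^{-1/2}` -/

section Representation

theorem mulOp_multiplier_ae_eq {a m : ℝ → ℂ} (ha : MemLp a ∞ volume) (hm : MemLp m ∞ volume)
    (hm2 : MemLp m 2 volume) (f : L2) :
    ∀ᵐ x, (mulOp a ha ∘L multiplier m hm) f x =
      inner ℂ (starRingEnd ℂ (a x) • (𝓕⁻ (twist m hm2 x) : L2)) f := by
  filter_upwards [coeFn_mulOp a ha (multiplier m hm f), fourierInv_mulOp_ae_eq hm hm2 (𝓕 f)]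
    with x h1 h2
  rw [ContinuousLinearMap.comp_apply, h1, multiplier_apply, h2, inner_smul_left, Complex.conj_conj,
    ← Lp.inner_fourier_eq (𝓕⁻ _), FourierTransform.fourier_fourierInv_eq]

/-- By Plancherel only the modulus of the symbol matters. The phase carrying `x` drops out, which
reflects the translation invariance of `H₀`. -/
theorem enorm_fourierInv_twist_sq {κ : ℝ} (hκ : 0 < κ) (x : ℝ) :
    ‖(𝓕⁻ (twist (sqrtSymbol κ) (memLp_two_sqrtSymbol hκ) x) : L2)‖ₑ ^ 2 =
      ENNReal.ofReal (1 / (2 * κ)) := by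
  rw [← ofReal_norm, ← Lp.norm_fourier_eq, FourierTransform.fourier_fourierInv_eq, ofReal_norm,
    enorm_twist_sq]
  simp only [enorm_sqrtSymbol_sq hκ]
  exact lintegral_symbol hκ

theorem inner_fourierInv_twist_self {κ : ℝ} (hκ : 0 < κ) (x : ℝ) :
    (inner ℂ (𝓕⁻ (twist (sqrtSymbol κ) (memLp_two_sqrtSymbol hκ) x) : L2)
      (𝓕⁻ (twist (sqrtSymbol κ) (memLp_two_sqrtSymbol hκ) x) : L2) : ℂ) = 1 / (2 * κ) := by
  have h := congrArg ENNReal.toReal (enorm_fourierInv_twist_sq hκ x)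
  rw [ENNReal.toReal_pow, toReal_enorm, ENNReal.toReal_ofReal (by positivity)] at h
  rw [inner_self_eq_norm_sq_to_K]
  have h' := congrArg (fun r : ℝ ↦ (r : ℂ)) h
  push_cast at h'
  exact h'

theorem lintegral_representation_ne_top {κ : ℝ} (hκ : 0 < κ) (V : 𝓢(ℝ, ℂ)) {a : ℝ → ℂ}
    (ha : ∀ x, ‖a x‖ = √‖V x‖) :
    ∫⁻ x, ‖starRingEnd ℂ (a x) •
      (𝓕⁻ (twist (sqrtSymbol κ) (memLp_two_sqrtSymbol hκ) x) : L2)‖ₑ ^ 2 ≠ ∞ := by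
  have e : ∀ x, ‖starRingEnd ℂ (a x) •
      (𝓕⁻ (twist (sqrtSymbol κ) (memLp_two_sqrtSymbol hκ) x) : L2)‖ₑ ^ 2 =
      ‖V x‖ₑ * ENNReal.ofReal (1 / (2 * κ)) := by
    intro x
    rw [enorm_smul, mul_pow, enorm_fourierInv_twist_sq hκ, RCLike.enorm_conj, ← ofReal_norm, ha,
      ← ENNReal.ofReal_pow (Real.sqrt_nonneg _), Real.sq_sqrt (norm_nonneg _), ofReal_norm]
  simp only [e]
  rw [lintegral_mul_const' _ _ ENNReal.ofReal_ne_top]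
  exact ENNReal.mul_ne_top (V.integrable (μ := volume)).2.ne ENNReal.ofReal_ne_top

theorem norm_factorV (V : 𝓢(ℝ, ℂ)) (x : ℝ) : ‖factorV V x‖ = √‖V x‖ := by
  rw [factorV, norm_real, Real.norm_of_nonneg (Real.sqrt_nonneg _)]

theorem norm_factorU (V : 𝓢(ℝ, ℂ)) (x : ℝ) : ‖factorU V x‖ = √‖V x‖ := by
  rw [factorU, norm_mul, mul_comm I, norm_exp_ofReal_mul_I, mul_one, norm_real,
    Real.norm_of_nonneg (Real.sqrt_nonneg _)]

theorem conj_factorV (V : 𝓢(ℝ, ℂ)) (x : ℝ) : factorV V x = starRingEnd ℂ (factorV V x) :=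
  (conj_ofReal _).symm

end Representation

/-! ### Factorization and the two traces -/

section Trace

variable (V : 𝓢(ℝ, ℂ)) {κ : ℝ}

/-- The operator `v (H₀ + κ²)^{-1/2}`. -/
def factorVSqrt (hκ : 0 < κ) : L2 →L[ℂ] L2 :=
  mulOp (factorV V) (memLp_factorV V) ∘L multiplier (sqrtSymbol κ) (memLp_top_sqrtSymbol hκ)

/-- The operator `u (H₀ + κ²)^{-1/2}`. -/
def factorUSqrt (hκ : 0 < κ) : L2 →L[ℂ] L2 :=
  mulOp (factorU V) (memLp_factorU V) ∘L multiplier (sqrtSymbol κ) (memLp_top_sqrtSymbol hκ)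

theorem adjoint_factorVSqrt (hκ : 0 < κ) : (factorVSqrt V hκ).adjoint =
    multiplier (sqrtSymbol κ) (memLp_top_sqrtSymbol hκ) ∘L
      mulOp (factorV V) (memLp_factorV V) := by
  symm
  rw [ContinuousLinearMap.eq_adjoint_iff]
  intro f g
  rw [factorVSqrt, ContinuousLinearMap.comp_apply, ContinuousLinearMap.comp_apply,
    inner_multiplier_left _ (conj_sqrtSymbol κ), inner_mulOp_left _ _ (conj_factorV V)]

theorem birmanSchwinger_eq (hκ : 0 < κ) :
    birmanSchwinger V κ = -((factorVSqrt V hκ).adjoint ∘L factorUSqrt V hκ) := by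
  rw [birmanSchwinger, adjoint_factorVSqrt, freeResolventSqrt_eq hκ]
  congr 1
  ext1 f
  simp only [factorUSqrt, ContinuousLinearMap.comp_apply]
  rw [mulOp_comp_mulOp _ _ (V.memLp_top volume)
    fun x ↦ by rw [mul_comm, factorU_mul_factorV]]

theorem symmetrizedResolvent_eq (hκ : 0 < κ) :
    symmetrizedResolvent V κ = factorUSqrt V hκ ∘L (factorVSqrt V hκ).adjoint := by
  rw [symmetrizedResolvent, adjoint_factorVSqrt]
  ext1 f
  simp only [factorUSqrt, ContinuousLinearMap.comp_apply, freeResolvent_eq hκ]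

theorem isHilbertSchmidt_factorVSqrt (hκ : 0 < κ) : IsHilbertSchmidt (factorVSqrt V hκ) :=
  IsHilbertSchmidt.of_representation (mulOp_multiplier_ae_eq _ _ (memLp_two_sqrtSymbol hκ))
    (lintegral_representation_ne_top hκ V (norm_factorV V))

theorem isHilbertSchmidt_factorUSqrt (hκ : 0 < κ) : IsHilbertSchmidt (factorUSqrt V hκ) :=
  IsHilbertSchmidt.of_representation (mulOp_multiplier_ae_eq _ _ (memLp_two_sqrtSymbol hκ))
    (lintegral_representation_ne_top hκ V (norm_factorU V))

/-- The representing vectors are multiples of the same `gₓ` with `‖gₓ‖² = 1/(2κ)`, and `v` is real,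
so the integrand is `u(x) v(x)/(2κ) = V(x)/(2κ)`. -/
theorem hasSum_inner_factorVSqrt_factorUSqrt (hκ : 0 < κ) {ι : Type} (b : HilbertBasis ι ℂ L2) :
    HasSum (fun i ↦ (inner ℂ (factorVSqrt V hκ (b i)) (factorUSqrt V hκ (b i)) : ℂ))
      (1 / (2 * κ) * ∫ x, V x) := by
  have h := hasSum_inner_of_representation
    (mulOp_multiplier_ae_eq (memLp_factorV V) (memLp_top_sqrtSymbol hκ) (memLp_two_sqrtSymbol hκ))
    (mulOp_multiplier_ae_eq (memLp_factorU V) (memLp_top_sqrtSymbol hκ) (memLp_two_sqrtSymbol hκ))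
    (lintegral_representation_ne_top hκ V (norm_factorV V))
    (lintegral_representation_ne_top hκ V (norm_factorU V)) b
  simp only [inner_smul_left, inner_smul_right, inner_fourierInv_twist_self hκ, Complex.conj_conj,
    ← conj_factorV] at h
  have e : ∀ x, factorV V x * (factorU V x * (1 / (2 * κ))) = 1 / (2 * κ) * V x := by
    intro x
    rw [← factorU_mul_factorV]
    ring
  simp only [e, integral_const_mul] at h
  exact h

theorem hasTrace_birmanSchwinger (hκ : 0 < κ) :
    HasTrace (birmanSchwinger V κ) (-(1 / (2 * κ) * ∫ x, V x)) := by
  rw [birmanSchwinger_eq V hκ]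
  exact ((isHilbertSchmidt_factorVSqrt V hκ).hasTrace_adjoint_comp
    (isHilbertSchmidt_factorUSqrt V hκ)
    fun ι b ↦ hasSum_inner_factorVSqrt_factorUSqrt V hκ b).neg

theorem hasTrace_symmetrizedResolvent (hκ : 0 < κ) :
    HasTrace (symmetrizedResolvent V κ) (1 / (2 * κ) * ∫ x, V x) := by
  rw [symmetrizedResolvent_eq V hκ]
  exact (isHilbertSchmidt_factorVSqrt V hκ).hasTrace_comp_adjoint
    (isHilbertSchmidt_factorUSqrt V hκ)
    fun ι b ↦ hasSum_inner_factorVSqrt_factorUSqrt V hκ b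

end Trace

/-! ### The Hilbert-Schmidt norm in momentum space -/

section HilbertSchmidtNorm

variable (V : 𝓢(ℝ, ℂ)) {κ : ℝ}

/-- After the Fourier transform the outer square root is multiplication by its symbol, while the
inner one is self-adjoint and moves onto the representing vector. Since `V` is in `L²`, `𝓕(V ·)` has
a pointwise representation, with `-ξ` because the forward transform is used. -/
theorem fourier_birmanSchwinger_ae_eq (hκ : 0 < κ) (f : L2) :
    ∀ᵐ ξ, (𝓕 (birmanSchwinger V κ f) : L2) ξ =
      inner ℂ (-(starRingEnd ℂ (sqrtSymbol κ ξ)) •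
        multiplier (sqrtSymbol κ) (memLp_top_sqrtSymbol hκ)
          (twist V (V.memLp 2 volume) (-ξ))) f := by
  set G := multiplier (sqrtSymbol κ) (memLp_top_sqrtSymbol hκ) with hG
  have e : birmanSchwinger V κ f = -(G (mulOp V (V.memLp_top volume) (G f))) := by
    rw [birmanSchwinger, freeResolventSqrt_eq hκ]
    rfl
  have e' : (𝓕 (birmanSchwinger V κ f) : L2) =
      -(mulOp (sqrtSymbol κ) (memLp_top_sqrtSymbol hκ)
        (𝓕 (mulOp V (V.memLp_top volume) (G f)))) := by
    rw [e, FourierTransform.fourier_neg, hG, fourier_multiplier]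
  rw [e']
  filter_upwards [Lp.coeFn_neg (mulOp (sqrtSymbol κ) (memLp_top_sqrtSymbol hκ)
      (𝓕 (mulOp V (V.memLp_top volume) (G f)))),
    coeFn_mulOp (sqrtSymbol κ) (memLp_top_sqrtSymbol hκ)
      (𝓕 (mulOp V (V.memLp_top volume) (G f))),
    fourier_mulOp_ae_eq (V.memLp_top volume) (V.memLp 2 volume) (G f)] with ξ h1 h2 h3
  rw [h1, Pi.neg_apply, h2, h3, inner_smul_left, map_neg, Complex.conj_conj, hG,
    inner_multiplier_left _ (conj_sqrtSymbol κ), neg_mul]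

theorem enorm_multiplier_twist_sq (hκ : 0 < κ) (ξ : ℝ) :
    ‖multiplier (sqrtSymbol κ) (memLp_top_sqrtSymbol hκ)
      (twist V (V.memLp 2 volume) (-ξ))‖ₑ ^ 2 =
      ∫⁻ η : ℝ, ENNReal.ofReal ((2 * π) ^ 2 * ‖η‖ ^ 2 + κ ^ 2)⁻¹ *
        ‖𝓕 (V : ℝ → ℂ) (ξ - η)‖ₑ ^ 2 := by
  rw [← ofReal_norm, ← Lp.norm_fourier_eq, ofReal_norm, fourier_multiplier, enorm_sq_eq_lintegral]
  refine lintegral_congr_ae ?_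
  filter_upwards [coeFn_mulOp (sqrtSymbol κ) (memLp_top_sqrtSymbol hκ)
      (𝓕 (twist V (V.memLp 2 volume) (-ξ))),
    fourier_twist_ae_eq V.integrable (V.memLp 2 volume) (-ξ)] with η h1 h2
  rw [h1, h2, enorm_mul, mul_pow, enorm_sqrtSymbol_sq hκ, RCLike.enorm_conj, neg_neg]

theorem lintegral_kernel_sq (hκ : 0 < κ) :
    ∫⁻ ξ, ‖-(starRingEnd ℂ (sqrtSymbol κ ξ)) •
        multiplier (sqrtSymbol κ) (memLp_top_sqrtSymbol hκ)
          (twist V (V.memLp 2 volume) (-ξ))‖ₑ ^ 2 =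
      ∫⁻ ζ, ‖𝓕 (V : ℝ → ℂ) ζ‖ₑ ^ 2 *
        ENNReal.ofReal (1 / κ * ((2 * π * ζ) ^ 2 + 4 * κ ^ 2)⁻¹) := by
  set ρ : ℝ → ℝ≥0∞ := fun ξ ↦ ENNReal.ofReal ((2 * π) ^ 2 * ‖ξ‖ ^ 2 + κ ^ 2)⁻¹ with hρ
  set F : ℝ → ℝ≥0∞ := fun ζ ↦ ‖𝓕 (V : ℝ → ℂ) ζ‖ₑ ^ 2 with hF
  have hρm : Measurable ρ := by fun_prop
  have hFm : Measurable F := by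
    have : Continuous (𝓕 (V : ℝ → ℂ)) := by
      rw [← SchwartzMap.fourier_coe]
      exact (𝓕 V).continuous
    have := this.measurable
    fun_prop
  have e : ∀ ξ, ‖-(starRingEnd ℂ (sqrtSymbol κ ξ)) •
        multiplier (sqrtSymbol κ) (memLp_top_sqrtSymbol hκ)
          (twist V (V.memLp 2 volume) (-ξ))‖ₑ ^ 2 = ∫⁻ ζ, ρ ξ * (ρ (ξ - ζ) * F ζ) := by
    intro ξ
    rw [enorm_smul, enorm_neg, mul_pow, RCLike.enorm_conj, enorm_sqrtSymbol_sq hκ,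
      enorm_multiplier_twist_sq V hκ, lintegral_const_mul' _ _ ENNReal.ofReal_ne_top,
      -- The substitution `η = ξ - ζ` frees the argument of `𝓕 V` from `ξ`.
      ← lintegral_sub_left_eq_self _ ξ]
    simp only [sub_sub_cancel, hρ, hF]
  simp only [e]
  rw [lintegral_lintegral_swap (by fun_prop)]
  refine lintegral_congr_ae ?_
  -- The partial fractions divide by `ζ`, so the null set `ζ = 0` is discarded.
  have h0 : ∀ᵐ ζ : ℝ, ζ ≠ 0 := by
    rw [ae_iff]
    simp
  filter_upwards [h0] with ζ hζ
  rw [← lintegral_symbol_mul_symbol hκ hζ, ← lintegral_const_mul _ (by fun_prop)]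
  refine lintegral_congr fun ξ ↦ ?_
  simp only [hρ, hF]
  ring

theorem tsum_enorm_birmanSchwinger_sq (hκ : 0 < κ) {ι : Type} (b : HilbertBasis ι ℂ L2) :
    ∑' i, ‖birmanSchwinger V κ (b i)‖ₑ ^ 2 = ENNReal.ofReal
      (1 / κ * ∫ η : ℝ, ‖unitaryFourier V η‖ ^ 2 / (η ^ 2 + 4 * κ ^ 2)) := by
  -- The sum is computed for `𝓕 ∘ A_V`; as `𝓕` is isometric, it equals the sum for `A_V` term by
  -- term.
  have h := tsum_enorm_sq_eq_lintegral
    (T := (Lp.fourierTransformₗᵢ ℝ ℂ).toContinuousLinearEquiv.toContinuousLinearMap ∘L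
      birmanSchwinger V κ) (fourier_birmanSchwinger_ae_eq V hκ) b
  rw [lintegral_kernel_sq V hκ] at h
  have hn : ∀ f, ‖((Lp.fourierTransformₗᵢ ℝ ℂ).toContinuousLinearEquiv.toContinuousLinearMap ∘L
      birmanSchwinger V κ) f‖ₑ = ‖birmanSchwinger V κ f‖ₑ := by
    intro f
    rw [← ofReal_norm, ← ofReal_norm]
    exact congrArg ENNReal.ofReal (Lp.norm_fourier_eq _)
  simp only [hn] at h
  have hint : Integrable fun ζ ↦
      1 / κ * (‖𝓕 (V : ℝ → ℂ) ζ‖ ^ 2 * ((2 * π * ζ) ^ 2 + 4 * κ ^ 2)⁻¹) := by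
    refine Integrable.const_mul ?_ _
    rw [← SchwartzMap.fourier_coe]
    refine Integrable.mul_bdd (c := (4 * κ ^ 2)⁻¹)
      (((𝓕 V).memLp 2 volume).integrable_norm_pow two_ne_zero) ?_
      (Filter.Eventually.of_forall fun ζ ↦ ?_)
    · refine (Continuous.inv₀ (by fun_prop) fun ζ ↦ ?_).aestronglyMeasurable
      positivity
    · rw [Real.norm_of_nonneg (by positivity)]
      exact inv_anti₀ (by positivity) (by nlinarith [sq_nonneg (2 * π * ζ)])
  rw [h, integral_unitaryFourier, ← integral_const_mul,
    ofReal_integral_eq_lintegral_ofReal hint (Filter.Eventually.of_forall fun ζ ↦ by positivity)]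
  refine lintegral_congr fun ζ ↦ ?_
  rw [← ofReal_norm, ← ENNReal.ofReal_pow (norm_nonneg _), ← ENNReal.ofReal_mul (by positivity)]
  congr 1
  ring

theorem hasHilbertSchmidtNorm_birmanSchwinger (hκ : 0 < κ) :
    HasHilbertSchmidtNorm (birmanSchwinger V κ)
      (√(1 / κ * ∫ η : ℝ, ‖unitaryFourier V η‖ ^ 2 / (η ^ 2 + 4 * κ ^ 2))) := by
  have hnn : 0 ≤ 1 / κ * ∫ η : ℝ, ‖unitaryFourier V η‖ ^ 2 / (η ^ 2 + 4 * κ ^ 2) :=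
    mul_nonneg (by positivity) (integral_nonneg fun η ↦ by positivity)
  refine ⟨Real.sqrt_nonneg _, fun ι b ↦ ?_⟩
  have h := tsum_enorm_birmanSchwinger_sq V hκ b
  have hs : Summable fun i ↦ ‖birmanSchwinger V κ (b i)‖ ^ 2 := by
    rw [summable_norm_sq_iff, h]
    exact ENNReal.ofReal_ne_top
  rw [Real.sq_sqrt hnn, ← ENNReal.toReal_ofReal hnn, ← h, ← tsum_norm_sq]
  exact hs.hasSum

end HilbertSchmidtNorm

end BirmanSchwinger

end

open BirmanSchwinger in
theorem proposition3p5 (V : 𝓢(ℝ, ℂ)) (κ : ℝ) (hκ : 0 < κ) :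
    IsTraceClass (birmanSchwinger V κ) ∧
    (∃ t τ : ℂ, HasTrace (birmanSchwinger V κ) t ∧ HasTrace (symmetrizedResolvent V κ) τ ∧
      t = -(1 / (2 * κ)) * (∫ x : ℝ, V x) ∧
      -(1 / (2 * κ)) * (∫ x : ℝ, V x) = -τ) ∧
    (∃ c : ℝ, HasHilbertSchmidtNorm (birmanSchwinger V κ) c ∧
      c ^ 2 = 1 / κ * (∫ η : ℝ, ‖unitaryFourier V η‖ ^ 2 / (η ^ 2 + 4 * κ ^ 2))) := by
  refine ⟨(hasTrace_birmanSchwinger V hκ).1,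
    ⟨_, _, hasTrace_birmanSchwinger V hκ, hasTrace_symmetrizedResolvent V hκ,
      (neg_mul _ _).symm, neg_mul _ _⟩,
    ⟨_, hasHilbertSchmidtNorm_birmanSchwinger V hκ, Real.sq_sqrt ?_⟩⟩
  exact mul_nonneg (by positivity) (integral_nonneg fun η ↦ by positivity)
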